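/- Let $M$ be a smooth manifold (Hausdorff, second countable) of dimension $2n+1$, $n\ge 0$, with an almost contact B-metric structure $(\varphi,\xi,\eta,g)$: $\varphi$ is a smooth endomorphism field of $TM$, $\xi$ a smooth vector field, $\eta$ a smooth 1-form and $g$ a pseudo-Riemannian metric of signature $(n+1,n)$ with $$\varphi\xi=0,\quad \varphi^2=-\mathrm{id}+\eta\otimes\xi,\quad \eta\circ\varphi=0,\quad \eta(\xi)=1,\quad g(\varphi x,\varphi y)=-g(x,y)+\eta(x)\eta(y).$$ Let $\nabla$ be the Levi-Civita connection of $g$, let $R(x,y)z=\nabla_x\nabla_yz-\nabla_y\nabla_xz-\nabla_{[x,y]}z$, let $\rho(y,z)=\operatorname{tr}\bigl(x\mapsto R(x,y)z\bigr)$ be the Ricci tensor and $\tau=\operatorname{tr}_g\rho$ the scalar curvature of $g$. Let $\tilde g(x,y)=g(x,\varphi y)+\eta(x)\eta(y)$ be the associated B-metric, and $\tilde\tau$ the scalar curvature of $\tilde g$, formed in the same way from the Levi-Civita connection of $\tilde g$. Suppose that the manifold is Sasaki-like, i.e. $$(\nabla_x\varphi)y=-g(x,y)\xi-\eta(y)x+2\eta(x)\eta(y)\xi$$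 for all vector fields $x,y$, and that it admits a Ricci-like soliton with potential $v$, i.e. there are a smooth vector field $v$ and real constants $\lambda,\mu,\nu$ with $$\tfrac12\mathcal L_vg+\rho+\lambda g+\mu\tilde g+\nu\,\eta\otimes\eta=0,$$ where $\mathcal L$ denotes the Lie derivative. Then: 1. $(\mathcal L_v\rho)(x,\xi)=0$ for every vector field $x$; 2. $\tau=2n$ on $M$; 3. $\tilde\tau$ is constant on $M$. -/

import Mathlib

open Bundle Manifold FiberBundle VectorField
open scoped ContDiff Topology Manifold

noncomputable section

namespace ContactB

section Smooth

variable {E : Type*} [NormedAddCommGroup E] [NormedSpace ℝ E] [FiniteDimensional ℝ E]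
  {H : Type*} [TopologicalSpace H] {I : ModelWithCorners ℝ E H}
  {M : Type*} [TopologicalSpace M] [ChartedSpace H M] [IsManifold I ∞ M]

theorem contMDiffAt_clm {F : Type*} [NormedAddCommGroup F] [NormedSpace ℝ F] {x₀ : M}
    {A : M → E →L[ℝ] F} (h : ∀ v, ContMDiffAt I 𝓘(ℝ, F) ∞ (fun x ↦ A x v) x₀) :
    ContMDiffAt I 𝓘(ℝ, E →L[ℝ] F) ∞ A x₀ := by
  let b := Module.finBasis ℝ E
  have hA : A = fun x ↦ ∑ i, ContinuousLinearMap.smulRightL ℝ E F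
      (LinearMap.toContinuousLinearMap (b.coord i)) (A x (b i)) := by
    funext x
    ext v
    conv_lhs => rw [← b.sum_repr v]
    rw [map_sum]
    simp
  rw [hA]
  refine contMDiffAt_finsetSum fun i _ ↦ ?_
  exact (ContinuousLinearMap.contMDiff _).contMDiffAt.comp x₀ (h (b i))

theorem contMDiffAt_hom_of_apply {F : Type*} [NormedAddCommGroup F] [NormedSpace ℝ F]
    {V : M → Type*} [TopologicalSpace (TotalSpace F V)] [∀ x, AddCommGroup (V x)]
    [∀ x, Module ℝ (V x)] [∀ x, TopologicalSpace (V x)] [∀ x, IsTopologicalAddGroup (V x)]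
    [∀ x, ContinuousSMul ℝ (V x)] [FiberBundle F V] [VectorBundle ℝ F V]
    (A : Π x : M, TangentSpace I x →L[ℝ] V x) {x₀ : M}
    (h : ∀ X : Π x : M, TangentSpace I x, CMDiffAt ∞ (T% X) x₀ →
      CMDiffAt ∞ (fun x ↦ TotalSpace.mk' F x (A x (X x))) x₀) :
    ContMDiffAt I (I.prod 𝓘(ℝ, E →L[ℝ] F)) ∞
      (fun x ↦ TotalSpace.mk' (E →L[ℝ] F) (E := fun x ↦ TangentSpace I x →L[ℝ] V x) x (A x)) x₀ := by
  rw [contMDiffAt_hom_bundle]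
  refine ⟨contMDiffAt_id, contMDiffAt_clm fun v ↦ ?_⟩
  let e := trivializationAt E (TangentSpace I : M → Type _) x₀
  let X : Π x : M, TangentSpace I x := fun x ↦ e.symmL ℝ x v
  have hX : CMDiffAt ∞ (T% X) x₀ := by
    rw [contMDiffAt_section]
    refine (contMDiffAt_const (c := v)).congr_of_eventuallyEq ?_
    filter_upwards [e.open_baseSet.mem_nhds (mem_baseSet_trivializationAt E _ x₀)] with y hy
    change (e ⟨y, e.symmL ℝ y v⟩).2 = v
    rw [e.symmL_apply hy, e.apply_mk_symm hy]
  have h2 := (contMDiffAt_section _).1 (h X hX)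
  refine h2.congr_of_eventuallyEq ?_
  filter_upwards [(trivializationAt F V x₀).open_baseSet.mem_nhds
    (mem_baseSet_trivializationAt F V x₀)] with y hy
  simp [ContinuousLinearMap.inCoordinates, X, e, hy]

end Smooth

/-! ## Pseudo-Riemannian metrics -/

section Metric

variable {E : Type*} [NormedAddCommGroup E] [NormedSpace ℝ E] [FiniteDimensional ℝ E]
  {H : Type*} [TopologicalSpace H] (I : ModelWithCorners ℝ E H)
  (M : Type*) [TopologicalSpace M] [ChartedSpace H M] [IsManifold I ∞ M]

/-- A smooth pseudo-Riemannian metric on `M`: a smooth field of symmetric nondegenerate bilinear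
forms on the tangent spaces. -/
structure PseudoMetric where
  inner : Π x : M, TangentSpace I x →L[ℝ] TangentSpace I x →L[ℝ] ℝ
  symm : ∀ (x : M) (v w : TangentSpace I x), inner x v w = inner x w v
  nondegenerate : ∀ (x : M) (v : TangentSpace I x), (∀ w, inner x v w = 0) → v = 0
  contMDiff : ContMDiff I (I.prod 𝓘(ℝ, E →L[ℝ] E →L[ℝ] ℝ)) ∞
    (fun x ↦ TotalSpace.mk' (E →L[ℝ] E →L[ℝ] ℝ) x (inner x))

variable {I M}

namespace PseudoMetric

variable (g : PseudoMetric I M)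

theorem mdifferentiableAt_inner {x : M} {X Y : Π x : M, TangentSpace I x}
    (hX : MDiffAt (T% X) x) (hY : MDiffAt (T% Y) x) :
    MDiffAt (fun y ↦ g.inner y (X y) (Y y)) x := by
  have h := (g.contMDiff x).mdifferentiableAt (by simp)
  have : MDifferentiableAt I (I.prod 𝓘(ℝ))
      (fun m ↦ TotalSpace.mk' ℝ (E := Bundle.Trivial M ℝ) m (g.inner m (X m) (Y m))) x := by
    apply MDifferentiableAt.clm_bundle_apply₂ (F₁ := E) (F₂ := E)
    · exact h
    · exact hX
    · exact hY
  simp only [mdifferentiableAt_totalSpace] at this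
  exact this.2

/-- The differential at `x` of the function `y ↦ g(X, Y)(y)`. -/
def dInner (X Y : Π x : M, TangentSpace I x) (x : M) : TangentSpace I x →L[ℝ] ℝ :=
  d% (fun y ↦ g.inner y (X y) (Y y)) x

theorem dInner_comm (X Y : Π x : M, TangentSpace I x) (x : M) :
    g.dInner X Y x = g.dInner Y X x := by
  simp only [dInner, g.symm _ (X _)]

theorem dInner_add_left {x : M} {X X' Y : Π x : M, TangentSpace I x}
    (hX : MDiffAt (T% X) x) (hX' : MDiffAt (T% X') x) (hY : MDiffAt (T% Y) x) :
    g.dInner (X + X') Y x = g.dInner X Y x + g.dInner X' Y x := by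
  have h := mvfderiv_add (g.mdifferentiableAt_inner hX hY) (g.mdifferentiableAt_inner hX' hY)
  rw [dInner, dInner, dInner, ← h]
  congr 1
  funext y
  simp

theorem dInner_smul_left {x : M} {f : M → ℝ} {X Y : Π x : M, TangentSpace I x}
    (hf : MDiffAt f x) (hX : MDiffAt (T% X) x) (hY : MDiffAt (T% Y) x) :
    g.dInner (f • X) Y x = f x • g.dInner X Y x + g.inner x (X x) (Y x) • d% f x := by
  have h := mvfderiv_mul hf (g.mdifferentiableAt_inner hX hY)
  rw [dInner, dInner, ← h]
  congr 1
  funext y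
  simp

theorem dInner_add_right {x : M} {X Y Y' : Π x : M, TangentSpace I x}
    (hX : MDiffAt (T% X) x) (hY : MDiffAt (T% Y) x) (hY' : MDiffAt (T% Y') x) :
    g.dInner X (Y + Y') x = g.dInner X Y x + g.dInner X Y' x := by
  rw [dInner_comm, g.dInner_add_left hY hY' hX, dInner_comm, g.dInner_comm Y']

theorem dInner_smul_right {x : M} {f : M → ℝ} {X Y : Π x : M, TangentSpace I x}
    (hf : MDiffAt f x) (hX : MDiffAt (T% X) x) (hY : MDiffAt (T% Y) x) :
    g.dInner X (f • Y) x = f x • g.dInner X Y x + g.inner x (X x) (Y x) • d% f x := by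
  rw [dInner_comm, g.dInner_smul_left hf hY hX, dInner_comm, g.symm]

/-- The right-hand side of the Koszul formula for `2 g(∇_X Y, Z)` at the point `x`, namely
`X g(Y, Z) + Y g(X, Z) - Z g(X, Y) + g([X, Y], Z) - g([X, Z], Y) - g([Y, Z], X)`. -/
def koszul (Y X Z : Π x : M, TangentSpace I x) (x : M) : ℝ :=
  g.dInner Y Z x (X x) + g.dInner X Z x (Y x) - g.dInner X Y x (Z x)
    + g.inner x (mlieBracket I X Y x) (Z x) - g.inner x (mlieBracket I X Z x) (Y x)
    - g.inner x (mlieBracket I Y Z x) (X x)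

theorem koszul_tensorial_left {x : M} {Y Z : Π x : M, TangentSpace I x}
    (hY : MDiffAt (T% Y) x) (hZ : MDiffAt (T% Z) x) :
    TensorialAt I E (fun X ↦ g.koszul Y X Z x) x where
  smul {f X} hf hX := by
    simp only [koszul, g.dInner_smul_left hf hX hZ, g.dInner_smul_left hf hX hY,
      mlieBracket_smul_left hf hX]
    simp
    ring
  add {X X'} hX hX' := by
    simp only [koszul, g.dInner_add_left hX hX' hZ, g.dInner_add_left hX hX' hY,
      mlieBracket_add_left hX hX']
    simp
    ring

theorem koszul_tensorial_right {x : M} {X Y : Π x : M, TangentSpace I x}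
    (hY : MDiffAt (T% Y) x) (hX : MDiffAt (T% X) x) :
    TensorialAt I E (fun Z ↦ g.koszul Y X Z x) x where
  smul {f Z} hf hZ := by
    simp only [koszul, g.dInner_smul_right hf hX hZ, g.dInner_smul_right hf hY hZ,
      mlieBracket_smul_right hf hZ]
    simp
    rw [g.symm x (Z x) (Y x), g.symm x (Z x) (X x)]
    ring
  add {Z Z'} hZ hZ' := by
    simp only [koszul, g.dInner_add_right hX hZ hZ', g.dInner_add_right hY hZ hZ',
      mlieBracket_add_right hZ hZ']
    simp
    ring

theorem koszul_add {x : M} {X Y Y' Z : Π x : M, TangentSpace I x} (hX : MDiffAt (T% X) x)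
    (hY : MDiffAt (T% Y) x) (hY' : MDiffAt (T% Y') x) (hZ : MDiffAt (T% Z) x) :
    g.koszul (Y + Y') X Z x = g.koszul Y X Z x + g.koszul Y' X Z x := by
  simp only [koszul, g.dInner_add_left hY hY' hZ, g.dInner_add_right hX hY hY',
    mlieBracket_add_left hY hY', mlieBracket_add_right hY hY']
  simp
  ring

theorem koszul_smul {x : M} {f : M → ℝ} {X Y Z : Π x : M, TangentSpace I x}
    (hf : MDiffAt f x) (hX : MDiffAt (T% X) x)
    (hY : MDiffAt (T% Y) x) (hZ : MDiffAt (T% Z) x) :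
    g.koszul (f • Y) X Z x =
      f x * g.koszul Y X Z x + 2 * (d% f x (X x) * g.inner x (Y x) (Z x)) := by
  simp only [koszul, g.dInner_smul_left hf hY hZ, g.dInner_smul_right hf hX hY,
    mlieBracket_smul_left hf hY, mlieBracket_smul_right hf hY]
  simp
  rw [g.symm x (Y x) (X x)]
  ring

/-- The Koszul expression as a bilinear form in `(X, Z)` on the tangent space at `x`. -/
def koszulForm (Y : Π x : M, TangentSpace I x) (x : M) (hY : MDiffAt (T% Y) x) :
    TangentSpace I x →L[ℝ] TangentSpace I x →L[ℝ] ℝ :=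
  TensorialAt.mkHom₂ (fun X Z ↦ g.koszul Y X Z x) x
    (fun _ hZ ↦ g.koszul_tensorial_left hY hZ) (fun _ hX ↦ g.koszul_tensorial_right hY hX)

theorem koszulForm_apply {x : M} {X Y Z : Π x : M, TangentSpace I x} (hX : MDiffAt (T% X) x)
    (hY : MDiffAt (T% Y) x) (hZ : MDiffAt (T% Z) x) :
    g.koszulForm Y x hY (X x) (Z x) = g.koszul Y X Z x :=
  TensorialAt.mkHom₂_apply _ _ hX hZ

theorem inner_bijective (x : M) :
    Function.Bijective (fun v : TangentSpace I x ↦ g.inner x v) := by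
  let B : E →ₗ[ℝ] E →L[ℝ] ℝ := ContinuousLinearMap.toLinearMap (g.inner x)
  have hinj : Function.Injective B := LinearMap.ker_eq_bot.1 <|
    LinearMap.ker_eq_bot'.2 fun v hv ↦ g.nondegenerate x v fun w ↦ DFunLike.congr_fun hv w
  have hdim : Module.finrank ℝ E = Module.finrank ℝ (E →L[ℝ] ℝ) := by
    rw [← (LinearMap.toContinuousLinearMap : (E →ₗ[ℝ] ℝ) ≃ₗ[ℝ] _).finrank_eq]
    exact Subspace.dual_finrank_eq.symm
  exact ⟨hinj, (LinearMap.injective_iff_surjective_of_finrank_eq_finrank hdim).1 hinj⟩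

/-- The musical isomorphism `v ↦ g(v, ·)` at the point `x`. -/
def flat (x : M) : TangentSpace I x ≃L[ℝ] (TangentSpace I x →L[ℝ] ℝ) :=
  ContinuousLinearEquiv.ofBijective (E := E) (F := E →L[ℝ] ℝ) (g.inner x)
    (LinearMap.ker_eq_bot.2 (g.inner_bijective x).1)
    (LinearMap.range_eq_top.2 (g.inner_bijective x).2)

theorem flat_apply (x : M) (v : TangentSpace I x) : g.flat x v = g.inner x v := rfl

theorem inner_flat_symm (x : M) (α : TangentSpace I x →L[ℝ] ℝ) :
    g.inner x ((g.flat x).symm α) = α :=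
  (g.flat x).apply_symm_apply α

theorem ext_inner {x : M} {v v' : TangentSpace I x}
    (h : ∀ w, g.inner x v w = g.inner x v' w) : v = v' :=
  (g.inner_bijective x).1 (ContinuousLinearMap.ext h)

open scoped Classical in
/-- The Levi-Civita derivative of `Y` at `x`, as the linear map `X ↦ ∇_X Y`, determined by the
Koszul formula (with value zero if `Y` is not differentiable at `x`). -/
def lcDeriv (Y : Π x : M, TangentSpace I x) (x : M) : TangentSpace I x →L[ℝ] TangentSpace I x :=
  if hY : MDiffAt (T% Y) x then
    (1 / 2 : ℝ) • ((g.flat x).symm : (TangentSpace I x →L[ℝ] ℝ) →L[ℝ] TangentSpace I x).comp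
      (g.koszulForm Y x hY)
  else 0

theorem two_inner_lcDeriv {x : M} {X Y Z : Π x : M, TangentSpace I x} (hX : MDiffAt (T% X) x)
    (hY : MDiffAt (T% Y) x) (hZ : MDiffAt (T% Z) x) :
    2 * g.inner x (g.lcDeriv Y x (X x)) (Z x) = g.koszul Y X Z x := by
  rw [lcDeriv, dif_pos hY, ← g.koszulForm_apply hX hY hZ]
  simp [inner_flat_symm]

theorem lcDeriv_ext {x : M} {L L' : TangentSpace I x →L[ℝ] TangentSpace I x}
    (h : ∀ X Z : Π x : M, TangentSpace I x, MDiffAt (T% X) x → MDiffAt (T% Z) x →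
      2 * g.inner x (L (X x)) (Z x) = 2 * g.inner x (L' (X x)) (Z x)) : L = L' := by
  ext1 a
  refine g.ext_inner fun c ↦ ?_
  have := h (extend E a) (extend E c) (mdifferentiableAt_extend ..) (mdifferentiableAt_extend ..)
  simpa using this

/-- The Levi-Civita connection of `g`. -/
def leviCivita : CovariantDerivative I E (TangentSpace I : M → Type _) where
  toFun := g.lcDeriv
  isCovariantDerivativeOnUniv :=
  { add := by
      intro Y Y' x hY hY' _
      have hsum : MDiffAt (T% (Y + Y')) x := mdifferentiableAt_add_section hY hY'
      refine g.lcDeriv_ext fun X Z hX hZ ↦ ?_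
      rw [g.two_inner_lcDeriv hX hsum hZ, g.koszul_add hX hY hY' hZ,
        ← g.two_inner_lcDeriv hX hY hZ, ← g.two_inner_lcDeriv hX hY' hZ]
      simp
      ring
    leibniz := by
      intro Y f x hY hf _
      have hsm : MDiffAt (T% (f • Y)) x := hf.smul_section hY
      refine g.lcDeriv_ext fun X Z hX hZ ↦ ?_
      rw [g.two_inner_lcDeriv hX hsm hZ, g.koszul_smul hf hX hY hZ,
        ← g.two_inner_lcDeriv hX hY hZ]
      simp
      ring }

theorem leviCivita_torsion : g.leviCivita.torsion = 0 := by
  rw [CovariantDerivative.torsion_eq_zero_iff]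
  intro X Y x hX hY
  refine g.ext_inner fun c ↦ ?_
  have hc := mdifferentiableAt_extend I E c
  have h1 := g.two_inner_lcDeriv hX hY hc
  have h2 := g.two_inner_lcDeriv hY hX hc
  simp only [koszul, extend_apply_self, g.dInner_comm Y X] at h1 h2
  rw [mlieBracket_swap_apply (V := Y) (W := X)] at h2
  simp only [leviCivita]
  simp at h2 ⊢
  linarith

theorem leviCivita_metric {x : M} {X Y Z : Π x : M, TangentSpace I x} (hX : MDiffAt (T% X) x)
    (hY : MDiffAt (T% Y) x) (hZ : MDiffAt (T% Z) x) :
    d% (fun y ↦ g.inner y (Y y) (Z y)) x (X x) =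
      g.inner x (g.leviCivita Y x (X x)) (Z x) + g.inner x (Y x) (g.leviCivita Z x (X x)) := by
  have h1 := g.two_inner_lcDeriv hX hY hZ
  have h2 := g.two_inner_lcDeriv hX hZ hY
  change g.dInner Y Z x (X x) = _
  simp only [leviCivita]
  rw [g.symm x (Y x)]
  simp only [koszul, g.dInner_comm Z Y] at h1 h2
  rw [mlieBracket_swap_apply (V := Z) (W := Y)] at h2
  simp at h2
  linarith


/-! ## Curvature -/

/-- The curvature `R(X, Y)Z = ∇_X ∇_Y Z - ∇_Y ∇_X Z - ∇_[X,Y] Z` on vector fields. -/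
def curvatureField (X Y Z : Π x : M, TangentSpace I x) (x : M) : TangentSpace I x :=
  g.leviCivita (fun y ↦ g.leviCivita Z y (Y y)) x (X x)
    - g.leviCivita (fun y ↦ g.leviCivita Z y (X y)) x (Y x)
    - g.leviCivita Z x (mlieBracket I X Y x)

/-- The curvature tensor at `x`. The value does not depend on the fields extending the three
tangent vectors; here the extensions with constant components in a local trivialization of the
tangent bundle are taken. -/
def curvature (x : M) (a b c : TangentSpace I x) : TangentSpace I x :=
  g.curvatureField (extend E a) (extend E b) (extend E c) x

/-- A basis of the tangent space at `x`. -/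
def tangentBasis (x : M) : Module.Basis (Fin (Module.finrank ℝ E)) ℝ (TangentSpace I x) :=
  Module.finBasis ℝ E

/-- The Ricci tensor at `x`: the trace of `a ↦ R(a, b)c`. -/
def ricci (x : M) (b c : TangentSpace I x) : ℝ :=
  ∑ i, (tangentBasis x).coord i (g.curvature x (tangentBasis x i) b c)

/-- The matrix of the metric at `x` in the basis `tangentBasis x`. -/
def gram (x : M) : Matrix (Fin (Module.finrank ℝ E)) (Fin (Module.finrank ℝ E)) ℝ :=
  Matrix.of fun i j ↦ g.inner x (tangentBasis x i) (tangentBasis x j)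

/-- The scalar curvature at `x`: the trace `g^{ij} ρ(e_i, e_j)` of the Ricci tensor. -/
def scalarCurvature (x : M) : ℝ :=
  ∑ i, ∑ j, (g.gram x)⁻¹ i j * g.ricci x (tangentBasis x i) (tangentBasis x j)

end PseudoMetric

/-- The Lie derivative of a `(0,2)`-tensor field `T` along `v`, evaluated on vector fields:
`(L_v T)(X, Y) = v (T(X, Y)) - T([v, X], Y) - T(X, [v, Y])`. -/
def lieDerivative (v : Π x : M, TangentSpace I x)
    (T : Π x : M, TangentSpace I x → TangentSpace I x → ℝ)
    (X Y : Π x : M, TangentSpace I x) (x : M) : ℝ :=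
  d% (fun y ↦ T y (X y) (Y y)) x (v x) - T x (mlieBracket I v X x) (Y x)
    - T x (X x) (mlieBracket I v Y x)

/-! ## Almost contact B-metric structures -/

variable (I M) in
/-- An almost contact B-metric structure `(φ, ξ, η, g)`, where `g` has signature `(n + 1, n)`. -/
structure AlmostContactBMetric (n : ℕ) where
  phi : Π x : M, TangentSpace I x →L[ℝ] TangentSpace I x
  xi : Π x : M, TangentSpace I x
  eta : Π x : M, TangentSpace I x →L[ℝ] ℝ
  metric : PseudoMetric I M
  contMDiff_phi : ContMDiff I (I.prod 𝓘(ℝ, E →L[ℝ] E)) ∞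
    (fun x ↦ TotalSpace.mk' (E →L[ℝ] E) (E := fun x : M ↦ TangentSpace I x →L[ℝ] TangentSpace I x)
      x (phi x))
  contMDiff_xi : CMDiff ∞ (T% xi)
  contMDiff_eta : ContMDiff I (I.prod 𝓘(ℝ, E →L[ℝ] ℝ)) ∞
    (fun x ↦ TotalSpace.mk' (E →L[ℝ] ℝ)
      (E := fun x : M ↦ TangentSpace I x →L[ℝ] Bundle.Trivial M ℝ x) x (eta x))
  phi_xi : ∀ x, phi x (xi x) = 0
  phi_phi : ∀ (x : M) (a : TangentSpace I x), phi x (phi x a) = -a + eta x a • xi x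
  eta_phi : ∀ (x : M) (a : TangentSpace I x), eta x (phi x a) = 0
  eta_xi : ∀ x, eta x (xi x) = 1
  metric_phi_phi : ∀ (x : M) (a b : TangentSpace I x),
    metric.inner x (phi x a) (phi x b) = -metric.inner x a b + eta x a * eta x b
  sigPos_metric : ∀ x, sigPos (metric.inner x).toBilinForm.toQuadraticMap = n + 1
  sigNeg_metric : ∀ x, sigNeg (metric.inner x).toBilinForm.toQuadraticMap = n

namespace AlmostContactBMetric

variable {n : ℕ} (S : AlmostContactBMetric I M n)

theorem metric_xi (x : M) (a : TangentSpace I x) : S.metric.inner x a (S.xi x) = S.eta x a := by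
  have h := S.metric_phi_phi x a (S.xi x)
  rw [S.phi_xi, S.eta_xi, map_zero] at h
  linarith

theorem metric_phi (x : M) (a b : TangentSpace I x) :
    S.metric.inner x a (S.phi x b) = S.metric.inner x (S.phi x a) b := by
  have h := S.metric_phi_phi x (S.phi x a) b
  rw [S.phi_phi, S.eta_phi] at h
  simp only [map_add, map_neg, map_smul, add_apply, neg_apply, smul_apply] at h
  rw [S.metric.symm x (S.xi x), S.metric_xi, S.eta_phi] at h
  simp at h
  linarith

/-- The bilinear form `g(a, φ b) + η(a) η(b) = g(φ a, b) + η(a) η(b)` at the point `x`. -/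
def associatedForm (x : M) : TangentSpace I x →L[ℝ] TangentSpace I x →L[ℝ] ℝ :=
  (S.metric.inner x).comp (S.phi x) + (S.eta x).smulRight (S.eta x)

theorem associatedForm_apply (x : M) (a b : TangentSpace I x) :
    S.associatedForm x a b = S.metric.inner x a (S.phi x b) + S.eta x a * S.eta x b := by
  simp [associatedForm, S.metric_phi]

/-- The associated metric `g̃(a, b) = g(a, φ b) + η(a) η(b)`. -/
def associatedMetric : PseudoMetric I M where
  inner := S.associatedForm
  symm x a b := by
    rw [associatedForm_apply, associatedForm_apply, S.metric_phi, S.metric.symm, mul_comm]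
  nondegenerate x a h := by
    have hxi := h (S.xi x)
    rw [associatedForm_apply, S.phi_xi, S.eta_xi] at hxi
    have ha : S.eta x a = 0 := by simpa using hxi
    refine S.metric.nondegenerate x a fun b ↦ ?_
    have hb := h (S.phi x b)
    rw [associatedForm_apply, S.phi_phi, ha] at hb
    simp [S.metric_xi, ha] at hb
    exact hb
  contMDiff x₀ := by
    refine contMDiffAt_hom_of_apply (V := fun x : M ↦ TangentSpace I x →L[ℝ] Bundle.Trivial M ℝ x)
      S.associatedForm fun X hX ↦ ?_
    refine contMDiffAt_hom_of_apply (V := Bundle.Trivial M ℝ)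
      (fun x ↦ S.associatedForm x (X x)) fun Y hY ↦ ?_
    have hphi : CMDiffAt ∞ (fun x ↦ TotalSpace.mk' E (E := (TangentSpace I : M → Type _)) x
        (S.phi x (Y x))) x₀ := (S.contMDiff_phi x₀).clm_bundle_apply hY
    have h1 : ContMDiffAt I (I.prod 𝓘(ℝ)) ∞ (fun x ↦ TotalSpace.mk' ℝ (E := Bundle.Trivial M ℝ) x
        (S.metric.inner x (X x) (S.phi x (Y x)))) x₀ :=
      ContMDiffAt.clm_bundle_apply₂ (F₁ := E) (F₂ := E) (S.metric.contMDiff x₀) hX hphi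
    have h2 : ContMDiffAt I (I.prod 𝓘(ℝ)) ∞ (fun x ↦ TotalSpace.mk' ℝ (E := Bundle.Trivial M ℝ) x
        (S.eta x (X x))) x₀ := (S.contMDiff_eta x₀).clm_bundle_apply hX
    have h3 : ContMDiffAt I (I.prod 𝓘(ℝ)) ∞ (fun x ↦ TotalSpace.mk' ℝ (E := Bundle.Trivial M ℝ) x
        (S.eta x (Y x))) x₀ := (S.contMDiff_eta x₀).clm_bundle_apply hY
    rw [contMDiffAt_section] at h1 h2 h3 ⊢
    exact (h1.add (h2.mul h3)).congr_of_eventuallyEq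
      (Filter.Eventually.of_forall fun x ↦ S.associatedForm_apply x (X x) (Y x))

/-- The covariant derivative `(∇_a φ) Y = ∇_a (φ Y) - φ (∇_a Y)` at `x`, with `∇` the Levi-Civita
connection of `g`. -/
def nablaPhi (Y : Π x : M, TangentSpace I x) (x : M) (a : TangentSpace I x) : TangentSpace I x :=
  S.metric.leviCivita (fun y ↦ S.phi y (Y y)) x a - S.phi x (S.metric.leviCivita Y x a)

/-- The Sasaki-like condition `(∇_a φ) Y = -g(a, Y) ξ - η(Y) a + 2 η(a) η(Y) ξ`. -/
def IsSasakiLike : Prop :=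
  ∀ (x : M) (a : TangentSpace I x) (Y : Π x : M, TangentSpace I x), MDiffAt (T% Y) x →
    S.nablaPhi Y x a = -(S.metric.inner x a (Y x)) • S.xi x - S.eta x (Y x) • a
      + (2 * S.eta x a * S.eta x (Y x)) • S.xi x

/-- The structure admits a Ricci-like soliton with potential `v` and constants
`(lam, mu, nu)`: `(1/2) L_v g + ρ + lam g + mu g̃ + nu η ⊗ η = 0`. -/
def IsRicciLikeSoliton (v : Π x : M, TangentSpace I x) (lam mu nu : ℝ) : Prop :=
  ∀ (x : M) (X Y : Π x : M, TangentSpace I x), MDiffAt (T% X) x → MDiffAt (T% Y) x →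
    (1 / 2) * lieDerivative v (fun y a b ↦ S.metric.inner y a b) X Y x
      + S.metric.ricci x (X x) (Y x)
      + lam * S.metric.inner x (X x) (Y x)
      + mu * S.associatedMetric.inner x (X x) (Y x)
      + nu * (S.eta x (X x) * S.eta x (Y x)) = 0

end AlmostContactBMetric
end Metric
end ContactB

end

noncomputable section

set_option linter.unusedSectionVars false

namespace ContactB

/-! ## Algebraic vector fields and connections -/

/-- The algebraic structure carried by the vector fields `X` on an open set with function
algebra `C`: a module of derivations of `C` closed under a Lie bracket. -/
structure FieldAlgebra (C X : Type*) [CommRing C] [Algebra ℝ C] [AddCommGroup X] [Module C X] where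
  act : X →ₗ[C] Derivation ℝ C C
  br : X →+ X →+ X
  br_self : ∀ x, br x x = 0
  br_smul : ∀ x (f : C) y, br x (f • y) = f • br x y + act x f • y
  jacobi : ∀ x y z, br x (br y z) = br (br x y) z + br y (br x z)
  act_br : ∀ x y f, act (br x y) f = act x (act y f) - act y (act x f)

variable {C X : Type*} [CommRing C] [Algebra ℝ C] [AddCommGroup X] [Module C X]

namespace FieldAlgebra

variable (L : FieldAlgebra C X)

theorem br_swap (x y : X) : L.br x y = -L.br y x := by
  have h := L.br_self (x + y)
  simp only [map_add, AddMonoidHom.add_apply, L.br_self] at h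
  rw [eq_neg_iff_add_eq_zero]
  simpa [add_comm] using h

theorem smul_br (f : C) (x y : X) : L.br (f • x) y = f • L.br x y - L.act y f • x := by
  rw [L.br_swap, L.br_smul, L.br_swap y x]
  module

theorem cyclic_br (x y z : X) :
    L.br (L.br x y) z + L.br (L.br y z) x + L.br (L.br z x) y = 0 := by
  have h := L.jacobi x y z
  rw [L.br_swap x (L.br y z), L.br_swap x z, L.br_swap y (-L.br z x)] at h
  simp only [map_neg, AddMonoidHom.neg_apply] at h
  rw [← sub_eq_zero, ← neg_eq_zero] at h
  rw [← h]
  abel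

theorem act_algebraMap (x : X) (r : ℝ) : L.act x (algebraMap ℝ C r) = 0 :=
  Derivation.map_algebraMap _ _

end FieldAlgebra

/-- A torsion free connection. -/
structure SymmConnection (L : FieldAlgebra C X) where
  nab : X →+ X →+ X
  smul_nab : ∀ (f : C) x y, nab (f • x) y = f • nab x y
  nab_smul : ∀ x (f : C) y, nab x (f • y) = f • nab x y + L.act x f • y
  torsion : ∀ x y, nab x y - nab y x = L.br x y

namespace SymmConnection

variable {L : FieldAlgebra C X} (D : SymmConnection L)

/-- The curvature tensor. -/
def curv : X →ₗ[C] X →ₗ[C] X →ₗ[C] X :=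
  LinearMap.mk₂ C (fun x y ↦
    { toFun := fun z ↦ D.nab x (D.nab y z) - D.nab y (D.nab x z) - D.nab (L.br x y) z
      map_add' := fun z w ↦ by simp only [map_add]; abel
      map_smul' := fun f z ↦ by
        simp only [D.nab_smul, map_add, L.act_br, RingHom.id_apply]; module })
    (fun x x' y ↦ by
      ext z; simp only [map_add, AddMonoidHom.add_apply, LinearMap.coe_mk, AddHom.coe_mk,
        LinearMap.add_apply]; abel)
    (fun f x y ↦ by
      ext z; simp only [L.smul_br, D.smul_nab, D.nab_smul, map_sub, AddMonoidHom.sub_apply,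
        LinearMap.coe_mk, AddHom.coe_mk, LinearMap.smul_apply]; module)
    (fun x y y' ↦ by
      ext z; simp only [map_add, AddMonoidHom.add_apply, LinearMap.coe_mk, AddHom.coe_mk,
        LinearMap.add_apply]; abel)
    (fun f x y ↦ by
      ext z; simp only [L.br_smul, D.smul_nab, D.nab_smul, map_add, AddMonoidHom.add_apply,
        LinearMap.coe_mk, AddHom.coe_mk, LinearMap.smul_apply]; module)

theorem curv_apply (x y z : X) :
    D.curv x y z = D.nab x (D.nab y z) - D.nab y (D.nab x z) - D.nab (L.br x y) z := rfl

theorem curv_swap (x y z : X) : D.curv x y z = -D.curv y x z := by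
  rw [D.curv_apply, D.curv_apply, L.br_swap x y]
  simp only [map_neg, AddMonoidHom.neg_apply]
  abel

theorem first_bianchi (x y z : X) : D.curv x y z + D.curv y z x + D.curv z x y = 0 := by
  have h := L.cyclic_br x y z
  simp only [D.curv_apply, ← D.torsion, map_sub, AddMonoidHom.sub_apply] at h ⊢
  rw [← neg_eq_zero, ← h]
  abel

/-- The covariant derivative of the curvature. -/
def nabCurv (w x y z : X) : X :=
  D.nab w (D.curv x y z) - D.curv (D.nab w x) y z - D.curv x (D.nab w y) z
    - D.curv x y (D.nab w z)

theorem second_bianchi (w x y z : X) :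
    D.nabCurv w x y z + D.nabCurv x y w z + D.nabCurv y w x z = 0 := by
  have h : D.curv (L.br w x) y z + D.curv (L.br x y) w z + D.curv (L.br y w) x z
      = D.nab w (D.curv x y z) - D.curv x y (D.nab w z)
        + (D.nab x (D.curv y w z) - D.curv y w (D.nab x z))
        + (D.nab y (D.curv w x z) - D.curv w x (D.nab y z)) := by
    have h2 := congrArg (fun t ↦ D.nab t z) (L.cyclic_br w x y)
    simp only [map_add, AddMonoidHom.add_apply, map_zero, AddMonoidHom.zero_apply] at h2
    rw [← sub_eq_zero, ← neg_eq_zero, ← h2]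
    simp only [D.curv_apply, map_sub]
    abel
  simp only [← D.torsion, map_sub, LinearMap.sub_apply] at h
  rw [D.curv_swap (D.nab x w) y z, D.curv_swap (D.nab y x) w z, D.curv_swap (D.nab w y) x z] at h
  rw [← sub_eq_zero] at h
  simp only [nabCurv]
  rw [← neg_eq_zero, ← h]
  abel

/-- The covariant derivative of an endomorphism. -/
def nabEnd (w : X) (A : X →ₗ[C] X) : X →ₗ[C] X where
  toFun x := D.nab w (A x) - A (D.nab w x)
  map_add' x y := by simp only [map_add]; abel
  map_smul' f x := by simp only [map_smul, D.nab_smul, map_add, RingHom.id_apply]; module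

theorem nabEnd_apply (w : X) (A : X →ₗ[C] X) (x : X) :
    D.nabEnd w A x = D.nab w (A x) - A (D.nab w x) := rfl

/-- The covariant derivative of a one-form. -/
def nabForm (w : X) (α : X →ₗ[C] C) : X →ₗ[C] C where
  toFun x := L.act w (α x) - α (D.nab w x)
  map_add' x y := by simp only [map_add]; abel
  map_smul' f x := by
    simp only [map_smul, D.nab_smul, map_add, RingHom.id_apply, smul_eq_mul, Derivation.leibniz]
    ring

variable [Module.Free C X] [Module.Finite C X]

theorem trace_nabEnd (w : X) (A : X →ₗ[C] X) :
    LinearMap.trace C X (D.nabEnd w A) = L.act w (LinearMap.trace C X A) := by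
  have hA : A = ∑ i, ((Module.Free.chooseBasis C X).coord i).smulRight
      (A (Module.Free.chooseBasis C X i)) := by
    ext x
    conv_lhs => rw [← (Module.Free.chooseBasis C X).sum_repr x]
    simp only [map_sum, map_smul, LinearMap.sum_apply, LinearMap.smulRight_apply,
      Module.Basis.coord_apply]
  have key : ∀ (α : X →ₗ[C] C) (y : X), LinearMap.trace C X (D.nabEnd w (α.smulRight y)) =
      L.act w (LinearMap.trace C X (α.smulRight y)) := fun α y ↦ by
    have : D.nabEnd w (α.smulRight y) =
        (D.nabForm w α).smulRight y + α.smulRight (D.nab w y) := by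
      ext x
      simp only [nabEnd_apply, LinearMap.smulRight_apply, LinearMap.add_apply, D.nab_smul, nabForm,
        LinearMap.coe_mk, AddHom.coe_mk]
      module
    rw [this, map_add, LinearMap.trace_smulRight, LinearMap.trace_smulRight,
      LinearMap.trace_smulRight]
    simp [nabForm]
  have hsum : D.nabEnd w A = ∑ i, D.nabEnd w (((Module.Free.chooseBasis C X).coord i).smulRight
      (A (Module.Free.chooseBasis C X i))) := by
    ext x
    conv_lhs => rw [nabEnd_apply, hA]
    simp [nabEnd_apply, LinearMap.sum_apply]
  rw [hsum, map_sum]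
  conv_rhs => rw [hA, map_sum, map_sum]
  exact Finset.sum_congr rfl fun i _ ↦ key _ _

/-- The Ricci tensor `tr (x ↦ R(x, y) z)`. -/
def ric (y z : X) : C := LinearMap.trace C X ((D.curv.flip y).flip z)

end SymmConnection

variable {C X : Type*} [CommRing C] [Algebra ℝ C] [AddCommGroup X] [Module C X]

namespace SymmConnection

variable {L : FieldAlgebra C X} (D : SymmConnection L)

/-- The connection obtained by adding a symmetric tensor. -/
def addTensor (S : X →ₗ[C] X →ₗ[C] X) (hS : ∀ x y, S x y = S y x) : SymmConnection L where
  nab := AddMonoidHom.mk' (fun x ↦ D.nab x + (S x).toAddMonoidHom) fun x y ↦ by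
    ext z; simp; abel
  smul_nab f x y := by simp [D.smul_nab]
  nab_smul x f y := by simp [D.nab_smul]; abel
  torsion x y := by simp [← D.torsion, hS x y]

theorem addTensor_nab (S : X →ₗ[C] X →ₗ[C] X) (hS : ∀ x y, S x y = S y x) (x y : X) :
    (D.addTensor S hS).nab x y = D.nab x y + S x y := rfl

/-- The metric compatibility of a connection. -/
def IsMetric (g : X →ₗ[C] X →ₗ[C] C) : Prop :=
  ∀ x y z, L.act x (g y z) = g (D.nab x y) z + g y (D.nab x z)

theorem IsMetric.koszul {D : SymmConnection L} {g : X →ₗ[C] X →ₗ[C] C}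
    (hg : ∀ x y, g x y = g y x) (h : D.IsMetric g) (x y z : X) :
    2 * g (D.nab x y) z = L.act y (g x z) + L.act x (g y z) - L.act z (g y x)
      - g (L.br y x) z - g (L.br x z) y - g (L.br y z) x := by
  simp only [h _, ← D.torsion, map_sub, LinearMap.sub_apply]
  rw [hg x (D.nab y z), hg y (D.nab x z), hg y (D.nab z x)]
  ring

theorem IsMetric.unique {D D' : SymmConnection L} {g : X →ₗ[C] X →ₗ[C] C}
    (hg : ∀ x y, g x y = g y x) (hnd : ∀ x, (∀ y, g x y = 0) → x = 0)
    (h : D.IsMetric g) (h' : D'.IsMetric g) : D.nab = D'.nab := by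
  ext x y
  rw [← sub_eq_zero]
  refine hnd _ fun z ↦ ?_
  have h1 := h.koszul hg x y z
  rw [← h'.koszul hg x y z] at h1
  have h2 : algebraMap ℝ C (1 / 2) * 2 = 1 := by
    rw [← map_ofNat (algebraMap ℝ C) 2, ← map_mul]; norm_num
  rw [map_sub, LinearMap.sub_apply]
  linear_combination algebraMap ℝ C (1 / 2) * h1
    - (g (D.nab x y) z - g (D'.nab x y) z) * h2

end SymmConnection

theorem eq_zero_of_two_mul {a : C} (h : 2 * a = 0) : a = 0 := by
  have h2 : algebraMap ℝ C (1 / 2) * 2 = 1 := by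
    rw [← map_ofNat (algebraMap ℝ C) 2, ← map_mul]; norm_num
  linear_combination algebraMap ℝ C (1 / 2) * h - a * h2

/-- The tensors of an almost contact B-metric structure. -/
structure BMetric (C X : Type*) [CommRing C] [Algebra ℝ C] [AddCommGroup X] [Module C X] where
  g : X →ₗ[C] X →ₗ[C] C
  φ : X →ₗ[C] X
  ξ : X
  η : X →ₗ[C] C
  symm : ∀ x y, g x y = g y x
  nondeg : ∀ x, (∀ y, g x y = 0) → x = 0
  phi_xi : φ ξ = 0
  phi_phi : ∀ x, φ (φ x) = -x + η x • ξ
  eta_phi : ∀ x, η (φ x) = 0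
  eta_xi : η ξ = 1
  phi_g : ∀ x y, g (φ x) (φ y) = -g x y + η x * η y

namespace BMetric

variable (B : BMetric C X)

theorem g_xi (x : X) : B.g x B.ξ = B.η x := by
  have h := B.phi_g x B.ξ
  rw [B.phi_xi, map_zero, B.eta_xi] at h
  linear_combination h

theorem xi_g (x : X) : B.g B.ξ x = B.η x := by rw [B.symm, B.g_xi]

theorem g_phi (x y : X) : B.g x (B.φ y) = B.g (B.φ x) y := by
  have h := B.phi_g (B.φ x) y
  rw [B.phi_phi, B.eta_phi] at h
  simp only [map_add, map_neg, map_smul, LinearMap.add_apply, LinearMap.neg_apply,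
    LinearMap.smul_apply, B.xi_g, B.eta_phi] at h
  simp only [smul_zero, zero_mul] at h
  linear_combination -h

/-- The B-metric structure with the associated metric. -/
def associated : BMetric C X where
  g := B.g.comp B.φ + B.η.smulRight B.η
  φ := B.φ
  ξ := B.ξ
  η := B.η
  symm x y := by simp [← B.g_phi, B.symm x, mul_comm]
  nondeg x h := by
    have h1 := h B.ξ
    simp [B.g_xi, B.eta_phi, B.eta_xi] at h1
    refine B.nondeg x fun y ↦ ?_
    have h2 := h (B.φ y)
    simpa [B.phi_g, h1] using h2
  phi_xi := B.phi_xi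
  phi_phi := B.phi_phi
  eta_phi := B.eta_phi
  eta_xi := B.eta_xi
  phi_g x y := by
    simp [B.eta_phi, B.phi_phi, B.xi_g, B.g_phi]

theorem associated_g (x y : X) : B.associated.g x y = B.g (B.φ x) y + B.η x * B.η y := by
  simp [associated]

/-- The difference of the parallel connection and the Levi-Civita connection of a Sasaki-like
structure. -/
def shape : X →ₗ[C] X →ₗ[C] X :=
  LinearMap.mk₂ C (fun x y ↦ B.η x • B.φ y + B.η y • B.φ x - B.g (B.φ x) y • B.ξ)
    (fun x x' y ↦ by simp only [map_add, LinearMap.add_apply]; module)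
    (fun f x y ↦ by simp only [map_smul, LinearMap.smul_apply, smul_eq_mul]; module)
    (fun x y y' ↦ by simp only [map_add]; module)
    (fun f x y ↦ by simp only [map_smul, smul_eq_mul]; module)

theorem shape_apply (x y : X) :
    B.shape x y = B.η x • B.φ y + B.η y • B.φ x - B.g (B.φ x) y • B.ξ := rfl

theorem shape_symm (x y : X) : B.shape x y = B.shape y x := by
  rw [shape_apply, shape_apply, ← B.g_phi, B.symm x]
  abel

variable {L : FieldAlgebra C X}

/-- A torsion free connection with parallel `φ`, `ξ`, `η` for which `g` rotates along `ξ`. -/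
structure IsParallel (D : SymmConnection L) : Prop where
  nab_xi : ∀ x, D.nab x B.ξ = 0
  nab_phi : ∀ x y, D.nab x (B.φ y) = B.φ (D.nab x y)
  act_eta : ∀ x y, L.act x (B.η y) = B.η (D.nab x y)
  act_g : ∀ x y z, L.act x (B.g y z) =
    B.g (D.nab x y) z + B.g y (D.nab x z) - 2 * B.η x * B.g (B.φ y) z

/-- The Sasaki-like condition for the Levi-Civita connection. -/
def IsSasakiLike (N : SymmConnection L) : Prop :=
  ∀ x y, N.nab x (B.φ y) - B.φ (N.nab x y) =
    -(B.g x y) • B.ξ - B.η y • x + (2 * B.η x * B.η y) • B.ξ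

variable {B}

theorem IsSasakiLike.nab_xi {N : SymmConnection L} (hN : N.IsMetric B.g)
    (h : B.IsSasakiLike N) (x : X) : N.nab x B.ξ = -B.φ x := by
  have h1 := h x B.ξ
  rw [B.phi_xi, map_zero, B.g_xi, B.eta_xi] at h1
  have h2 := congrArg B.φ h1
  simp only [map_add, map_sub, map_smul, map_zero, B.phi_phi, B.phi_xi] at h2
  have h3 := hN x B.ξ B.ξ
  rw [B.g_xi, B.xi_g, B.g_xi, B.eta_xi, Derivation.map_one_eq_zero] at h3
  have h4 : B.η (N.nab x B.ξ) = 0 := eq_zero_of_two_mul (by linear_combination -h3)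
  rw [h4] at h2
  simp only [zero_smul, smul_zero, add_zero] at h2
  have h5 : N.nab x B.ξ = -((1 : C) • B.φ x) := by
    rw [← sub_eq_zero, ← sub_eq_zero.2 h2]
    module
  rwa [one_smul] at h5

theorem IsSasakiLike.isParallel {N : SymmConnection L} (hN : N.IsMetric B.g)
    (h : B.IsSasakiLike N) : B.IsParallel (N.addTensor B.shape B.shape_symm) where
  nab_xi x := by
    rw [N.addTensor_nab, h.nab_xi hN, B.shape_apply, B.phi_xi, B.eta_xi, B.g_xi, B.eta_phi]
    module
  nab_phi x y := by
    have h1 := sub_eq_iff_eq_add.1 (h x y)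
    simp only [N.addTensor_nab, h1, B.shape_apply, map_add, map_sub, map_smul, B.phi_xi, B.phi_phi,
      B.eta_phi, B.phi_g]
    module
  act_eta x y := by
    have h1 := hN x y B.ξ
    rw [B.g_xi, B.g_xi, h.nab_xi hN] at h1
    rw [h1, N.addTensor_nab, B.shape_apply]
    simp only [map_add, map_sub, map_smul, map_neg, B.eta_phi, B.eta_xi, B.symm y,
      LinearMap.neg_apply, smul_eq_mul]
    ring
  act_g x y z := by
    have e : B.g x (B.φ z) = B.g (B.φ x) z := B.g_phi x z
    have e2 : B.g y (B.φ z) = B.g (B.φ y) z := B.g_phi y z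
    simp only [hN x y z, N.addTensor_nab, B.shape_apply, map_add, map_sub, map_smul,
      LinearMap.add_apply, LinearMap.sub_apply, LinearMap.smul_apply, B.g_xi, B.xi_g, smul_eq_mul,
      e2, B.symm y (B.φ x)]
    ring

namespace IsParallel

variable {D : SymmConnection L} (hD : B.IsParallel D)
include hD

theorem associated : B.associated.IsParallel D where
  nab_xi := hD.nab_xi
  nab_phi := hD.nab_phi
  act_eta := hD.act_eta
  act_g x y z := by
    simp only [B.associated_g, map_add, hD.act_g, Derivation.leibniz, hD.act_eta, smul_eq_mul,
      hD.nab_phi]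
    simp only [BMetric.associated, B.eta_phi]
    ring

end IsParallel
end BMetric

variable {C X : Type*} [CommRing C] [Algebra ℝ C] [AddCommGroup X] [Module C X]

namespace SymmConnection

variable {L : FieldAlgebra C X} (D : SymmConnection L)

/-- The covariant derivative of the Ricci tensor. -/
def nabRic (w y z : X) : C :=
  L.act w (D.ric y z) - D.ric (D.nab w y) z - D.ric y (D.nab w z)

theorem nabRic_eq [Module.Free C X] [Module.Finite C X] (w y z : X) (A : X →ₗ[C] X)
    (hA : ∀ x, A x = D.nabCurv w x y z) : D.nabRic w y z = LinearMap.trace C X A := by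
  have h : A = D.nabEnd w ((D.curv.flip y).flip z) - (D.curv.flip (D.nab w y)).flip z
      - (D.curv.flip y).flip (D.nab w z) := by
    ext x
    simp only [hA, nabCurv, LinearMap.sub_apply, nabEnd_apply, LinearMap.flip_apply]
  rw [h, map_sub, map_sub, D.trace_nabEnd]
  rfl

theorem nabRic_eq_trace [Module.Free C X] [Module.Finite C X] (w y z : X) :
    ∃ A : X →ₗ[C] X, (∀ x, A x = D.nabCurv w x y z) ∧
      D.nabRic w y z = LinearMap.trace C X A := by
  refine ⟨D.nabEnd w ((D.curv.flip y).flip z) - (D.curv.flip (D.nab w y)).flip z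
      - (D.curv.flip y).flip (D.nab w z), fun x ↦ ?_, D.nabRic_eq _ _ _ _ fun x ↦ ?_⟩ <;>
  · simp only [nabCurv, LinearMap.sub_apply, nabEnd_apply, LinearMap.flip_apply]

end SymmConnection

namespace BMetric

variable {B : BMetric C X} {L : FieldAlgebra C X}

theorem ext_g {x x' : X} (h : ∀ w, B.g x w = B.g x' w) : x = x' :=
  sub_eq_zero.1 <| B.nondeg _ fun w ↦ by simp [h w]

namespace IsParallel

variable {D : SymmConnection L} (hD : B.IsParallel D)
include hD

theorem act_gphi (x y z : X) : L.act x (B.g (B.φ y) z) =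
    B.g (B.φ (D.nab x y)) z + B.g (B.φ y) (D.nab x z)
      + 2 * B.η x * (B.g y z - B.η y * B.η z) := by
  rw [hD.act_g, hD.nab_phi, B.phi_phi]
  simp only [map_add, map_neg, map_smul, LinearMap.add_apply, LinearMap.neg_apply,
    LinearMap.smul_apply, B.xi_g, smul_eq_mul]
  ring

theorem curv_phi (x y z : X) : D.curv x y (B.φ z) = B.φ (D.curv x y z) := by
  simp only [D.curv_apply, hD.nab_phi, map_sub]

theorem curv_xi (x y : X) : D.curv x y B.ξ = 0 := by
  simp only [D.curv_apply, hD.nab_xi, map_zero, sub_zero]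

theorem eta_curv (x y z : X) : B.η (D.curv x y z) = 0 := by
  have h := L.act_br x y (B.η z)
  simp only [hD.act_eta] at h
  simp only [D.curv_apply, map_sub, h, sub_self]

theorem g_curv (x y z w : X) : B.g (D.curv x y z) w = -B.g (D.curv x y w) z := by
  have h := L.act_br x y (B.g z w)
  have ht := congrArg B.η (D.torsion x y)
  rw [map_sub] at ht
  simp only [hD.act_g, hD.nab_phi, map_add, map_sub, Derivation.leibniz, smul_eq_mul,
    hD.act_eta] at h
  have h2 : ∀ v, L.act v (2 : C) = 0 := fun v ↦ by
    simpa only [map_ofNat] using L.act_algebraMap v 2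
  rw [h2, h2] at h
  rw [B.symm _ z]
  simp only [D.curv_apply, map_sub, LinearMap.sub_apply]
  linear_combination -h + 2 * B.g (B.φ z) w * ht

theorem pair_symm (x y z w : X) : B.g (D.curv x y z) w = B.g (D.curv z w x) y := by
  have b : ∀ x y z w : X, B.g (D.curv x y z) w + B.g (D.curv y z x) w
      + B.g (D.curv z x y) w = 0 := fun x y z w ↦ by
    simpa using congrArg (fun t ↦ B.g t w) (D.first_bianchi x y z)
  have s : ∀ x y z w : X, B.g (D.curv x y z) w = -B.g (D.curv y x z) w := fun x y z w ↦ by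
    rw [D.curv_swap]; simp
  have k := hD.g_curv
  rw [← sub_eq_zero]
  refine eq_zero_of_two_mul ?_
  have e1 := b x y z w
  have e2 := b y z w x
  have e3 := b z w x y
  have e4 := b w x y z
  rw [k y z w x, k z w y x, s w y z x] at e2
  rw [s w x z y, k x w z y, s x z w y, k z x w y] at e3
  rw [s w x y z, k x y w z, k y w x z] at e4
  linear_combination e1 + e2 - e3 - e4

theorem curv_phi_left_eq (x y z : X) : D.curv (B.φ x) y z = D.curv x (B.φ y) z := by
  refine B.ext_g fun w ↦ ?_
  rw [hD.pair_symm, hD.curv_phi, ← B.g_phi, ← hD.pair_symm]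

theorem curv_phi_left (x y z : X) : D.curv (B.φ x) y z = B.φ (D.curv x y z) := by
  refine B.ext_g fun w ↦ sub_eq_zero.1 <| eq_zero_of_two_mul ?_
  have b : ∀ x y z : X, B.g (D.curv x y z) w + B.g (D.curv y z x) w
      + B.g (D.curv z x y) w = 0 := fun x y z ↦ by
    simpa using congrArg (fun t ↦ B.g t w) (D.first_bianchi x y z)
  have e1 := b (B.φ x) y z
  have e2 := b x (B.φ y) z
  have e3 := b x y (B.φ z)
  have e4 := congrArg (fun t ↦ B.g (B.φ t) w) (D.first_bianchi x y z)
  simp only [map_add, LinearMap.add_apply, map_zero, LinearMap.zero_apply] at e4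
  rw [← hD.curv_phi_left_eq z x y, hD.curv_phi] at e1
  rw [← hD.curv_phi_left_eq x y z, hD.curv_phi] at e2
  rw [← hD.curv_phi_left_eq y z x, hD.curv_phi] at e3
  linear_combination e1 + e2 - e3 - e4

theorem curv_phi_right (x y z : X) : D.curv x (B.φ y) z = B.φ (D.curv x y z) := by
  rw [← hD.curv_phi_left_eq, hD.curv_phi_left]

theorem curv_xi_left (y z : X) : D.curv B.ξ y z = 0 := by
  refine B.ext_g fun w ↦ ?_
  rw [hD.pair_symm, hD.curv_xi]
  simp

theorem curv_xi_right (x z : X) : D.curv x B.ξ z = 0 := by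
  rw [D.curv_swap, hD.curv_xi_left, neg_zero]

theorem ric_phi (y z : X) : D.ric (B.φ y) z = D.ric y (B.φ z) := by
  refine congrArg (LinearMap.trace C X) ?_
  ext x
  simp only [LinearMap.flip_apply, hD.curv_phi_right, hD.curv_phi]

theorem ric_xi (z : X) : D.ric B.ξ z = 0 := by
  have : (D.curv.flip B.ξ).flip z = 0 := by
    ext x
    simp [hD.curv_xi_right]
  rw [SymmConnection.ric, this, map_zero]

theorem nabCurv_xi (x y z : X) : D.nabCurv B.ξ x y z = 0 := by
  have h := D.second_bianchi B.ξ x y z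
  have h1 : D.nabCurv x y B.ξ z = 0 := by
    simp [SymmConnection.nabCurv, hD.curv_xi_right, hD.nab_xi]
  have h2 : D.nabCurv y B.ξ x z = 0 := by
    simp [SymmConnection.nabCurv, hD.curv_xi_left, hD.nab_xi]
  simpa [h1, h2] using h

theorem nabCurv_phi (w x y z : X) : D.nabCurv (B.φ w) x y z = D.nabCurv w x y (B.φ z) := by
  have h := D.second_bianchi (B.φ w) x y z
  have h0 := D.second_bianchi w x y (B.φ z)
  have h1 : D.nabCurv x y (B.φ w) z = D.nabCurv x y w (B.φ z) := by
    simp only [SymmConnection.nabCurv, hD.curv_phi_right, hD.nab_phi, hD.curv_phi]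
  have h2 : D.nabCurv y (B.φ w) x z = D.nabCurv y w x (B.φ z) := by
    simp only [SymmConnection.nabCurv, hD.curv_phi_left, hD.nab_phi, hD.curv_phi]
  rw [h1, h2, ← h0] at h
  simpa using h

theorem nabRic_phi (w y z : X) : D.nabRic w (B.φ y) z = D.nabRic w y (B.φ z) := by
  simp only [SymmConnection.nabRic, hD.nab_phi, hD.ric_phi]

theorem nabRic_xi_middle (w z : X) : D.nabRic w B.ξ z = 0 := by
  have : D.ric 0 z = 0 := by
    have h0 : (D.curv.flip 0).flip z = 0 := by ext x; simp
    rw [SymmConnection.ric, h0, map_zero]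
  simp [SymmConnection.nabRic, hD.nab_xi, hD.ric_xi, this]

section Trace

variable [Module.Free C X] [Module.Finite C X]

theorem nabRic_xi (y z : X) : D.nabRic B.ξ y z = 0 := by
  rw [D.nabRic_eq B.ξ y z 0 fun x ↦ by simp [hD.nabCurv_xi], map_zero]

theorem nabRic_phi_left (w y z : X) : D.nabRic (B.φ w) y z = D.nabRic w y (B.φ z) := by
  obtain ⟨A, hA, h⟩ := D.nabRic_eq_trace w y (B.φ z)
  rw [h, D.nabRic_eq _ _ _ A fun x ↦ by rw [hA, hD.nabCurv_phi]]

end Trace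

theorem nab_eq {N : SymmConnection L} (hN : N.IsMetric B.g) (x y : X) :
    N.nab x y = D.nab x y - B.shape x y := by
  have hS : ∀ x y, (-B.shape) x y = (-B.shape) y x := fun x y ↦ by
    simp only [LinearMap.neg_apply, B.shape_symm]
  have hm : (D.addTensor (-B.shape) hS).IsMetric B.g := fun x y z ↦ by
    have e2 : B.g y (B.φ z) = B.g (B.φ y) z := B.g_phi y z
    simp only [hD.act_g x y z, D.addTensor_nab, LinearMap.neg_apply, B.shape_apply, map_add,
      map_sub, map_smul, map_neg, LinearMap.add_apply, LinearMap.sub_apply, LinearMap.smul_apply,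
      B.g_xi, B.xi_g, smul_eq_mul, e2, B.symm y (B.φ x)]
    ring
  have h := hN.unique B.symm B.nondeg hm
  rw [h, D.addTensor_nab, LinearMap.neg_apply, LinearMap.neg_apply, sub_eq_add_neg]

theorem curv_leviCivita {N : SymmConnection L} (hN : N.IsMetric B.g) (x y z : X) :
    N.curv x y z = D.curv x y z + B.η z • (B.η y • x - B.η x • y)
      - B.g (B.φ y) z • B.φ x + B.g (B.φ x) z • B.φ y
      + (B.η x * B.g y z - B.η y * B.g x z) • B.ξ := by
  have e2 : B.g x (B.φ z) = B.g (B.φ x) z := B.g_phi x z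
  have e3 : B.g y (B.φ z) = B.g (B.φ y) z := B.g_phi y z
  have e4 : B.g (B.φ y) x = B.g (B.φ x) y := by rw [← B.g_phi, B.symm]
  rw [N.curv_apply, D.curv_apply]
  simp only [hD.nab_eq hN, B.shape_apply, map_sub, map_add, D.nab_smul, hD.nab_xi, hD.nab_phi,
    smul_zero, zero_add, hD.act_gphi, hD.act_eta, map_smul, B.phi_phi, B.phi_xi, B.eta_phi,
    B.eta_xi, B.phi_g, B.g_xi, smul_eq_mul, ← D.torsion, AddMonoidHom.sub_apply,
    B.symm y x]
  module

theorem ric_leviCivita [Module.Free C X] [Module.Finite C X] {N : SymmConnection L}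
    (hN : N.IsMetric B.g) {k : C} (hφ : LinearMap.trace C X B.φ = 0)
    (hk : LinearMap.trace C X LinearMap.id = k + 1) (y z : X) :
    N.ric y z = D.ric y z + k * (B.η y * B.η z) := by
  have h : (N.curv.flip y).flip z = (D.curv.flip y).flip z
      + (B.η y * B.η z) • LinearMap.id - (B.η z • B.η).smulRight y
      - B.g (B.φ y) z • B.φ + (B.g.flip z ∘ₗ B.φ).smulRight (B.φ y)
      + (B.g y z • B.η - B.η y • B.g.flip z).smulRight B.ξ := by
    ext x
    simp only [LinearMap.flip_apply, hD.curv_leviCivita hN, LinearMap.add_apply,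
      LinearMap.sub_apply, LinearMap.smul_apply, LinearMap.smulRight_apply, LinearMap.id_apply,
      LinearMap.comp_apply, smul_eq_mul]
    module
  rw [SymmConnection.ric, h]
  simp only [map_add, map_sub, map_smul, hφ, hk, LinearMap.trace_smulRight, LinearMap.smul_apply,
    LinearMap.comp_apply, LinearMap.flip_apply, LinearMap.sub_apply, B.eta_xi, B.xi_g, B.phi_phi,
    map_neg, smul_eq_mul, SymmConnection.ric]
  ring

end IsParallel
end BMetric

variable {C X : Type*} [CommRing C] [Algebra ℝ C] [AddCommGroup X] [Module C X]

namespace SymmConnection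

variable {L : FieldAlgebra C X} (D : SymmConnection L) (v : X)

/-- The Lie derivative of a connection. -/
def lieNab (x y : X) : X :=
  L.br v (D.nab x y) - D.nab (L.br v x) y - D.nab x (L.br v y)

theorem lieNab_symm (x y : X) : D.lieNab v x y = D.lieNab v y x := by
  have h := L.jacobi v x y
  simp only [← D.torsion x y, ← D.torsion (L.br v x) y, ← D.torsion x (L.br v y), map_sub] at h
  rw [← sub_eq_zero] at h ⊢
  rw [← h, lieNab, lieNab]
  abel

end SymmConnection

namespace BMetric

variable (B : BMetric C X) {L : FieldAlgebra C X}

variable (L) in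
/-- The Lie derivative of `φ` along `v`. -/
def liePhi (v : X) : X →ₗ[C] X where
  toFun x := L.br v (B.φ x) - B.φ (L.br v x)
  map_add' x y := by simp only [map_add]; abel
  map_smul' f x := by simp only [map_smul, L.br_smul, map_add, RingHom.id_apply]; module

theorem liePhi_apply (v x : X) : B.liePhi L v x = L.br v (B.φ x) - B.φ (L.br v x) := rfl

/-- The Ricci-like soliton equation in terms of the Ricci tensor of the parallel connection. -/
def IsSoliton (D : SymmConnection L) (v : X) (l m a : ℝ) : Prop :=
  ∀ y z, L.act v (B.g y z) = B.g (L.br v y) z + B.g y (L.br v z)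
    - 2 * (D.ric y z + algebraMap ℝ C l * (B.g y z - B.η y * B.η z)
      + algebraMap ℝ C m * B.g (B.φ y) z + algebraMap ℝ C a * (B.η y * B.η z))

variable {B}

theorem phi_phi_phi (x : X) : B.φ (B.φ (B.φ x)) = -B.φ x := by
  rw [B.phi_phi, B.eta_phi, zero_smul, add_zero]

namespace IsParallel

variable {D : SymmConnection L} (hD : B.IsParallel D)
include hD

theorem ric_xi_right (y : X) : D.ric y B.ξ = 0 := by
  have : (D.curv.flip y).flip B.ξ = 0 := by
    ext x
    simp [hD.curv_xi]
  rw [SymmConnection.ric, this, map_zero]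

theorem ric_phi_phi (y z : X) : D.ric (B.φ (B.φ y)) z = -D.ric y z := by
  rw [SymmConnection.ric, SymmConnection.ric, ← map_neg]
  refine congrArg (LinearMap.trace C X) ?_
  ext x
  rw [LinearMap.flip_apply, LinearMap.flip_apply, hD.curv_phi_right, hD.curv_phi_right, B.phi_phi,
    hD.eta_curv, zero_smul, add_zero]
  rfl

theorem nabRic_xi_right (w y : X) : D.nabRic w y B.ξ = 0 := by
  have h0 : D.ric y 0 = 0 := by
    have h0 : (D.curv.flip y).flip 0 = 0 := by ext x; simp
    rw [SymmConnection.ric, h0, map_zero]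
  simp [SymmConnection.nabRic, hD.nab_xi, hD.ric_xi_right, h0]

theorem lie_eta (v x : X) : L.act v (B.η x) = B.η (L.br v x) + L.act x (B.η v) := by
  rw [hD.act_eta, hD.act_eta, ← D.torsion, map_sub, sub_add_cancel]

theorem lieNab_xi (v x : X) : D.lieNab v x B.ξ = -D.nab x (L.br v B.ξ) := by
  simp [SymmConnection.lieNab, hD.nab_xi]

theorem liePhi_phi (v x : X) : B.liePhi L v (B.φ x) =
    -B.φ (B.liePhi L v x) + L.act x (B.η v) • B.ξ + B.η x • L.br v B.ξ := by
  have h := hD.lie_eta v x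
  simp only [liePhi_apply, B.phi_phi, map_add, map_sub, map_neg, L.br_smul, h]
  module

omit hD in
theorem liePhi_xi (v : X) : B.liePhi L v B.ξ = -B.φ (L.br v B.ξ) := by
  simp [liePhi_apply, B.phi_xi]

theorem eta_liePhi (v x : X) : B.η (B.liePhi L v x) = -L.act (B.φ x) (B.η v) := by
  have h := hD.lie_eta v (B.φ x)
  rw [B.eta_phi, map_zero] at h
  rw [liePhi_apply, map_sub, B.eta_phi]
  linear_combination -h

theorem nab_liePhi (v x y : X) : D.nab x (B.liePhi L v y) =
    B.liePhi L v (D.nab x y) + B.φ (D.lieNab v x y) - D.lieNab v x (B.φ y) := by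
  simp only [liePhi_apply, SymmConnection.lieNab, hD.nab_phi, map_sub]
  abel

variable {v : X} {l m a : ℝ} (hs : B.IsSoliton D v l m a)
include hs

theorem g_br_xi (x : X) : B.g x (L.br v B.ξ) = L.act x (B.η v) + 2 * algebraMap ℝ C a * B.η x := by
  have h := hs x B.ξ
  have h1 := hD.lie_eta v x
  simp only [B.g_xi, hD.ric_xi_right, B.eta_xi, B.eta_phi, h1] at h
  linear_combination -h

theorem eta_br_xi : B.η (L.br v B.ξ) = algebraMap ℝ C a := by
  have h := hD.g_br_xi hs B.ξ
  have h1 := hD.lie_eta v B.ξ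
  rw [B.xi_g, B.eta_xi] at h
  rw [B.eta_xi, Derivation.map_one_eq_zero] at h1
  exact sub_eq_zero.1 (eq_zero_of_two_mul (by linear_combination h - h1))

theorem act_xi_eta : L.act B.ξ (B.η v) = -algebraMap ℝ C a := by
  have h1 := hD.lie_eta v B.ξ
  rw [B.eta_xi, Derivation.map_one_eq_zero, hD.eta_br_xi hs] at h1
  linear_combination -h1

theorem act_xi_act_eta (y : X) :
    L.act B.ξ (L.act y (B.η v)) = L.act (D.nab B.ξ y) (B.η v) := by
  have h := L.act_br B.ξ y (B.η v)
  rw [hD.act_xi_eta hs, map_neg, L.act_algebraMap, ← D.torsion, hD.nab_xi, sub_zero] at h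
  linear_combination -h

theorem lieNab_metric (x y z : X) :
    B.g (D.lieNab v x y) z + B.g y (D.lieNab v x z) =
      -2 * D.nabRic x y z + 2 * L.act x (B.η v) * B.g (B.φ y) z
        + 2 * B.η x * (B.g (B.liePhi L v y) z - 2 * D.ric (B.φ y) z) := by
  have h2 : ∀ v, L.act v (2 : C) = 0 := fun v ↦ by
    simpa only [map_ofNat] using L.act_algebraMap v 2
  have h := L.act_br v x (B.g y z)
  have h1 := hD.lie_eta v x
  rw [hs y z] at h
  simp only [map_add, map_sub, Derivation.leibniz, smul_eq_mul, h2, hs _ _, hD.act_g,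
    L.act_algebraMap, h1, hD.act_eta x, B.eta_phi] at h
  have hT : L.br v (B.φ y) = B.liePhi L v y + B.φ (L.br v y) := by
    rw [liePhi_apply]; abel
  have hc : L.act x (D.ric y z) = D.nabRic x y z + D.ric (D.nab x y) z + D.ric y (D.nab x z) := by
    rw [SymmConnection.nabRic]; ring
  have e5 : B.g (B.φ (B.φ y)) z = -B.g y z + B.η y * B.η z := by rw [← B.g_phi, B.phi_g]
  simp only [hc, hT, hD.nab_phi, map_add, LinearMap.add_apply, e5] at h
  simp only [SymmConnection.lieNab, map_sub, LinearMap.sub_apply, hD.act_eta x]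
  linear_combination -h

end IsParallel
end BMetric

variable {C X : Type*} [CommRing C] [Algebra ℝ C] [AddCommGroup X] [Module C X]

namespace BMetric

variable {B : BMetric C X} {L : FieldAlgebra C X}

theorem g_phi_phi (x y : X) : B.g (B.φ (B.φ x)) y = -B.g x y + B.η x * B.η y := by
  rw [← B.g_phi, B.phi_g]

namespace IsParallel

variable {D : SymmConnection L} (hD : B.IsParallel D)
  {v : X} {l m a : ℝ} (hs : B.IsSoliton D v l m a)
include hD hs

/-- The right-hand side of the formula for the Lie derivative of the connection. -/
theorem two_g_lieNab (x y z : X) {P : X → X → X → C}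
    (hP : ∀ x y z, P x y z = -2 * D.nabRic x y z + 2 * L.act x (B.η v) * B.g (B.φ y) z
        + 2 * B.η x * (B.g (B.liePhi L v y) z - 2 * D.ric (B.φ y) z)) :
    2 * B.g (D.lieNab v x y) z = P x y z + P y x z - P z x y := by
  have h1 := hD.lieNab_metric hs x y z
  have h2 := hD.lieNab_metric hs y x z
  have h3 := hD.lieNab_metric hs z x y
  rw [← hP] at h1 h2 h3
  rw [D.lieNab_symm v y x] at h2
  rw [D.lieNab_symm v z x, D.lieNab_symm v z y] at h3
  rw [← h1, ← h2, ← h3, B.symm x (D.lieNab v y z), B.symm y (D.lieNab v x z)]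
  ring

variable [Module.Free C X] [Module.Finite C X]

theorem act_g_liePhi (x y z : X) : L.act x (B.g (B.liePhi L v (B.φ y)) (B.φ z)) =
    B.g (B.liePhi L v (B.φ (D.nab x y))) (B.φ z) + B.g (B.liePhi L v (B.φ y)) (B.φ (D.nab x z))
      - L.act (B.φ y) (B.η v) * B.g (B.φ x) z - L.act (B.φ z) (B.η v) * B.g (B.φ x) y
      + L.act (B.φ (B.φ y)) (B.η v) * (B.g x z - B.η x * B.η z)
      + L.act (B.φ (B.φ z)) (B.η v) * (B.g x y - B.η x * B.η y) := by
  have h1 := hD.two_g_lieNab hs x (B.φ y) (B.φ (B.φ z)) fun _ _ _ ↦ rfl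
  have h2 := hD.two_g_lieNab hs x (B.φ (B.φ y)) (B.φ z) fun _ _ _ ↦ rfl
  have hT : B.liePhi L v (B.φ (B.φ y)) =
      -B.φ (B.liePhi L v (B.φ y)) + L.act (B.φ y) (B.η v) • B.ξ := by
    rw [hD.liePhi_phi, B.eta_phi, zero_smul, add_zero]
  simp only [B.eta_phi, phi_phi_phi, hT, hD.nabRic_phi_left, hD.nabRic_phi, mul_zero, zero_mul,
    add_zero, map_add, map_neg, map_smul, LinearMap.add_apply, LinearMap.neg_apply,
    LinearMap.smul_apply, B.xi_g, smul_eq_mul] at h1 h2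
  have e1 : B.g (B.φ x) (B.φ (B.φ z)) = -B.g (B.φ x) z := by
    rw [B.g_phi, B.phi_g, B.eta_phi]; ring
  have e2 : B.g (B.φ x) (B.φ (B.φ y)) = -B.g (B.φ x) y := by
    rw [B.g_phi, B.phi_g, B.eta_phi]; ring
  have e3 : D.ric (-B.φ y) (B.φ z) = D.ric (B.φ (B.φ y)) (B.φ (B.φ z)) := by
    rw [← phi_phi_phi, hD.ric_phi]
  have e4 : B.g (B.φ (B.φ y)) (B.φ (B.φ z)) = -B.g (B.φ y) (B.φ z) := by
    rw [B.phi_g, B.eta_phi]; ring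
  have e5 : B.g (B.liePhi L v (B.φ y)) (B.φ (B.φ z)) =
      B.g (B.φ (B.liePhi L v (B.φ y))) (B.φ z) := B.g_phi _ _
  rw [e1, e4, e5] at h1
  rw [e2, e3, B.phi_g] at h2
  rw [hD.act_g, hD.nab_liePhi, hD.nab_phi, hD.nab_phi]
  simp only [map_add, map_sub, LinearMap.add_apply, LinearMap.sub_apply]
  rw [← B.g_phi (D.lieNab v x (B.φ y))]
  refine sub_eq_zero.1 (eq_zero_of_two_mul ?_)
  rw [B.phi_g, B.phi_g x] at h1
  rw [B.phi_g x] at h2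
  linear_combination h1 - h2

theorem act_br_xi_eq (y z x : X) :
    L.act (B.φ y) (B.η v) * (B.g x z - B.η x * B.η z)
      + L.act (B.φ z) (B.η v) * (B.g x y - B.η x * B.η y)
      + L.act (B.φ (B.φ y)) (B.η v) * B.g (B.φ x) z
      + L.act (B.φ (B.φ z)) (B.η v) * B.g (B.φ x) y = 0 := by
  have hS := hD.act_g_liePhi hs
  have hξ : ∀ y z, L.act B.ξ (B.g (B.liePhi L v (B.φ y)) (B.φ z)) =
      B.g (B.liePhi L v (B.φ (D.nab B.ξ y))) (B.φ z)
        + B.g (B.liePhi L v (B.φ y)) (B.φ (D.nab B.ξ z)) := fun y z ↦ by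
    rw [hS, B.phi_xi, B.eta_xi, B.xi_g, B.xi_g]
    simp
  have hc := L.act_br B.ξ x (B.g (B.liePhi L v (B.φ y)) (B.φ z))
  have hxi : ∀ y, L.br B.ξ y = D.nab B.ξ y := fun y ↦ by
    rw [← D.torsion, hD.nab_xi, sub_zero]
  have hR : ∀ y, D.nab B.ξ (D.nab x y) = D.nab x (D.nab B.ξ y) + D.nab (D.nab B.ξ x) y :=
    fun y ↦ by
      have h := hD.curv_xi_left x y
      rw [D.curv_apply, hxi, sub_sub, sub_eq_zero] at h
      exact h
  have hth : ∀ y, L.act B.ξ (L.act (B.φ y) (B.η v)) = L.act (B.φ (D.nab B.ξ y)) (B.η v) :=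
    fun y ↦ by rw [hD.act_xi_act_eta hs, hD.nab_phi]
  rw [hxi, hξ y z, map_add, hS, hS, hS, hS] at hc
  simp only [map_add, map_sub, Derivation.leibniz, smul_eq_mul, hξ, hth, hD.nab_phi B.ξ, hD.act_eta B.ξ,
    hD.act_gphi B.ξ, hD.act_g B.ξ, hR, LinearMap.add_apply, B.eta_xi] at hc
  refine eq_zero_of_two_mul ?_
  linear_combination hc

theorem act_phi_eta (hφ : LinearMap.trace C X B.φ = 0) {k : C} (hk : IsUnit k)
    (hid : LinearMap.trace C X LinearMap.id = k + 1) (y : X) : L.act (B.φ y) (B.η v) = 0 := by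
  let θ : X →ₗ[C] C :=
    { toFun := fun x ↦ L.act x (B.η v)
      map_add' := fun x y ↦ by simp
      map_smul' := fun f x ↦ by simp }
  have hA : θ (B.φ y) • (LinearMap.id - B.η.smulRight B.ξ)
      + (θ ∘ₗ B.φ).smulRight (y - B.η y • B.ξ) + θ (B.φ (B.φ y)) • B.φ
      + (θ ∘ₗ B.φ ∘ₗ B.φ).smulRight (B.φ y) = 0 := by
    ext z
    refine B.nondeg _ fun x ↦ ?_
    have h := hD.act_br_xi_eq hs y z x
    rw [B.symm]
    simp only [LinearMap.add_apply, LinearMap.smul_apply, LinearMap.sub_apply, LinearMap.id_apply,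
      LinearMap.smulRight_apply, LinearMap.comp_apply, map_add, map_smul, map_sub, smul_eq_mul,
      B.g_xi, B.g_phi, θ, LinearMap.coe_mk, AddHom.coe_mk]
    linear_combination h
  have ht := congrArg (LinearMap.trace C X) hA
  simp only [map_add, map_smul, map_sub, hid, hφ, LinearMap.trace_smulRight, LinearMap.comp_apply,
    B.eta_xi, B.phi_xi, phi_phi_phi, map_zero, map_neg, smul_eq_mul] at ht
  refine hk.mul_right_eq_zero.1 ?_
  change k * θ (B.φ y) = 0
  linear_combination ht

/-- A Ricci-like soliton with positive-dimensional contact distribution is Ricci flat for the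
parallel connection, and its potential preserves `ξ` and `η`. -/
theorem soliton_rigidity (hφ : LinearMap.trace C X B.φ = 0) {k : C} (hk : IsUnit k)
    (hid : LinearMap.trace C X LinearMap.id = k + 1) :
    (∀ y z, D.ric y z = 0) ∧ (∀ x, L.act x (B.η v) = 0) ∧ B.η (L.br v B.ξ) = 0 := by
  set α : C := algebraMap ℝ C a with hα
  have hθ : ∀ x, L.act x (B.η v) = -α * B.η x := fun x ↦ by
    have h := hD.act_phi_eta hs hφ hk hid (B.φ x)
    rw [B.phi_phi, map_add, map_smul, map_neg, Derivation.add_apply, Derivation.smul_apply,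
      Derivation.neg_apply, hD.act_xi_eta hs, smul_eq_mul] at h
    linear_combination -h
  have hu : L.br v B.ξ = α • B.ξ := by
    refine B.ext_g fun w ↦ ?_
    rw [B.symm, hD.g_br_xi hs, hθ, map_smul, LinearMap.smul_apply, B.xi_g, smul_eq_mul]
    ring
  have hric0 : ∀ z, D.ric 0 z = 0 := fun z ↦ by
    have h0 : (D.curv.flip 0).flip z = 0 := by ext x; simp
    rw [SymmConnection.ric, h0, map_zero]
  have hT : ∀ x z, B.g (B.liePhi L v x) z = 2 * D.ric (B.φ x) z + α * B.g (B.φ x) z := by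
    intro x z
    have h := hD.two_g_lieNab hs x B.ξ z fun _ _ _ ↦ rfl
    have e : D.lieNab v x B.ξ = 0 := by
      rw [hD.lieNab_xi, hu, D.nab_smul, hD.nab_xi, hα, L.act_algebraMap]; simp
    rw [e, hD.nabRic_xi_middle, hD.nabRic_xi, hD.nabRic_xi_right, B.phi_xi, liePhi_xi, hu,
      hric0, hD.ric_xi_right, B.g_xi, B.g_xi, B.eta_phi, hD.eta_liePhi,
      hθ (B.φ x), hθ B.ξ, B.eta_phi, B.eta_xi] at h
    simp only [map_smul, B.phi_xi, map_zero, smul_zero, neg_zero, LinearMap.zero_apply] at h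
    refine sub_eq_zero.1 (eq_zero_of_two_mul ?_)
    linear_combination -h
  have hr : ∀ y z, 2 * D.ric y z = -α * (B.g y z - B.η y * B.η z) := fun y z ↦ by
    have h := hT (B.φ y) z
    rw [hD.liePhi_phi, hθ, hu, B.g_phi_phi, hD.ric_phi_phi] at h
    simp only [map_add, map_neg, map_smul, LinearMap.add_apply, LinearMap.neg_apply,
      LinearMap.smul_apply, B.xi_g, smul_eq_mul] at h
    rw [← B.g_phi, hT, B.phi_g, ← hD.ric_phi, hD.ric_phi_phi] at h
    refine sub_eq_zero.1 (eq_zero_of_two_mul ?_)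
    linear_combination h
  have hα0 : α = 0 := by
    have h1 : ∀ y z, α * B.g (B.φ y) z = 0 := fun y z ↦ by
      have h := hD.nabRic_xi y z
      have h2 := congrArg (L.act B.ξ) (hr y z)
      have h3 : L.act B.ξ (2 : C) = 0 := by
        simpa only [map_ofNat] using L.act_algebraMap B.ξ 2
      simp only [Derivation.leibniz, smul_eq_mul, h3, map_neg, map_sub, hα, L.act_algebraMap,
        hD.act_g B.ξ, hD.act_eta B.ξ, B.eta_xi] at h2
      rw [SymmConnection.nabRic] at h
      refine eq_zero_of_two_mul ?_
      linear_combination 2 * h - h2 + hr (D.nab B.ξ y) z + hr y (D.nab B.ξ z)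
    have h2 : α • (B.η.smulRight B.ξ - LinearMap.id : X →ₗ[C] X) = 0 := by
      ext y
      refine B.nondeg _ fun z ↦ ?_
      have h := h1 (B.φ y) z
      rw [B.g_phi_phi] at h
      simp only [LinearMap.smul_apply, LinearMap.sub_apply, LinearMap.smulRight_apply,
        LinearMap.id_apply, map_smul, map_sub, B.xi_g, smul_eq_mul]
      linear_combination h
    have ht := congrArg (LinearMap.trace C X) h2
    simp only [map_smul, map_sub, LinearMap.trace_smulRight, hid, B.eta_xi, map_zero,
      smul_eq_mul] at ht
    refine hk.mul_left_eq_zero.1 ?_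
    linear_combination -ht
  refine ⟨fun y z ↦ eq_zero_of_two_mul ?_, fun x ↦ ?_, ?_⟩
  · rw [hr, hα0, neg_zero, zero_mul]
  · rw [hθ, hα0, neg_zero, zero_mul]
  · rw [hu, map_smul, hα0, zero_smul]

end IsParallel
end BMetric

section Smoothness

variable {E : Type*} [NormedAddCommGroup E] [NormedSpace ℝ E] [FiniteDimensional ℝ E]
  {H : Type*} [TopologicalSpace H] {I : ModelWithCorners ℝ E H}
  {M : Type*} [TopologicalSpace M] [ChartedSpace H M] [IsManifold I ∞ M]

theorem contMDiffAt_mlieBracket {X Y : Π x : M, TangentSpace I x} {x : M}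
    (hX : CMDiffAt ∞ (T% X) x) (hY : CMDiffAt ∞ (T% Y) x) :
    CMDiffAt ∞ (T% (mlieBracket I X Y)) x := by
  have := FiniteDimensional.complete ℝ E
  have : IsManifold I ((⊤ : ℕ∞) + 1) M := inferInstanceAs (IsManifold I ∞ M)
  have : IsManifold I (minSmoothness ℝ 2) M := by
    rw [minSmoothness_of_isRCLikeNormedField]
    infer_instance
  exact ContMDiffAt.mlieBracket_vectorField (m := ⊤) (n := ⊤) hX hY
    (by rw [minSmoothness_of_isRCLikeNormedField]; rfl)

theorem jacobi_mlieBracket {X Y Z : Π x : M, TangentSpace I x} {x : M}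
    (hX : CMDiffAt ∞ (T% X) x) (hY : CMDiffAt ∞ (T% Y) x) (hZ : CMDiffAt ∞ (T% Z) x) :
    mlieBracket I X (mlieBracket I Y Z) x =
      mlieBracket I (mlieBracket I X Y) Z x + mlieBracket I Y (mlieBracket I X Z) x := by
  have := FiniteDimensional.complete ℝ E
  have : IsManifold I (minSmoothness ℝ 3) M := by
    rw [minSmoothness_of_isRCLikeNormedField]
    infer_instance
  have h : minSmoothness ℝ 2 ≤ ∞ := by
    rw [minSmoothness_of_isRCLikeNormedField]
    exact ENat.LEInfty.out
  exact leibniz_identity_mlieBracket_apply (hX.of_le h) (hY.of_le h) (hZ.of_le h)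

theorem eventually_mdifferentiableAt {X : Π x : M, TangentSpace I x} {x : M}
    (hX : CMDiffAt ∞ (T% X) x) : ∀ᶠ y in 𝓝 x, MDiffAt (T% X) y := by
  have h1 : CMDiffAt 1 (T% X) x := hX.of_le (by simp)
  filter_upwards [(contMDiffAt_iff_contMDiffAt_nhds (by simp)).1 h1] with y hy
  exact hy.mdifferentiableAt (by simp)

theorem eventually_mdifferentiableAt_fun {f : M → ℝ} {x : M}
    (hf : CMDiffAt ∞ f x) : ∀ᶠ y in 𝓝 x, MDiffAt f y := by
  have h1 : CMDiffAt 1 f x := hf.of_le (by simp)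
  filter_upwards [(contMDiffAt_iff_contMDiffAt_nhds (by simp)).1 h1] with y hy
  exact hy.mdifferentiableAt (by simp)

variable (I) in
/-- The frame of the tangent bundle over the domain of the preferred chart at `x`. -/
def frame (x : M) (i : Fin (Module.finrank ℝ E)) : Π y : M, TangentSpace I y :=
  (trivializationAt E (TangentSpace I : M → Type _) x).localFrame (Module.finBasis ℝ E) i

variable (I) in
/-- The coordinates in the frame over the domain of the preferred chart at `x`. -/
def frameCoeff (x : M) (i : Fin (Module.finrank ℝ E)) (y : M) : TangentSpace I y →ₗ[ℝ] ℝ :=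
  (trivializationAt E (TangentSpace I : M → Type _) x).localFrameCoeff I (Module.finBasis ℝ E) i y

theorem contMDiffAt_frame {x y : M}
    (hy : y ∈ (trivializationAt E (TangentSpace I : M → Type _) x).baseSet)
    (i : Fin (Module.finrank ℝ E)) : CMDiffAt ∞ (T% (frame I x i)) y :=
  contMDiffAt_localFrame_of_mem (V := (TangentSpace I : M → Type _)) ∞ _ _ i hy

theorem contMDiffAt_iff_frameCoeff {x y : M}
    (hy : y ∈ (trivializationAt E (TangentSpace I : M → Type _) x).baseSet)
    {X : Π x : M, TangentSpace I x} :
    CMDiffAt ∞ (T% X) y ↔ ∀ i, CMDiffAt ∞ (fun z ↦ frameCoeff I x i z (X z)) y :=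
  contMDiffAt_iff_localFrameCoeff (V := (TangentSpace I : M → Type _)) _ hy

theorem sum_frameCoeff {x y : M}
    (hy : y ∈ (trivializationAt E (TangentSpace I : M → Type _) x).baseSet)
    (a : TangentSpace I y) : ∑ i, frameCoeff I x i y a • frame I x i y = a := by
  have h := Bundle.Trivialization.eq_sum_localFrameCoeff_smul (I := I) (b := Module.finBasis ℝ E)
    (s := extend E a) hy
  simp only [extend_apply_self] at h
  exact h.symm

theorem frameCoeff_frame {x y : M}
    (hy : y ∈ (trivializationAt E (TangentSpace I : M → Type _) x).baseSet)
    (i j : Fin (Module.finrank ℝ E)) :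
    frameCoeff I x i y (frame I x j y) = if j = i then 1 else 0 := by
  rw [frameCoeff, Bundle.Trivialization.localFrameCoeff_apply_of_mem_baseSet _ _ hy,
    frame, Bundle.Trivialization.localFrame_apply_of_mem_baseSet _ _ hy]
  simp [Finsupp.single_apply]

theorem frameCoeff_apply {x y : M}
    (hy : y ∈ (trivializationAt E (TangentSpace I : M → Type _) x).baseSet)
    (i : Fin (Module.finrank ℝ E)) (a : TangentSpace I y) :
    frameCoeff I x i y a = ((trivializationAt E (TangentSpace I : M → Type _) x).basisAt
      (Module.finBasis ℝ E) hy).repr a i := by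
  have h := Bundle.Trivialization.localFrameCoeff_apply_of_mem_baseSet (I := I)
    (trivializationAt E (TangentSpace I : M → Type _) x) (Module.finBasis ℝ E) hy (extend E a) i
  rw [extend_apply_self] at h
  exact h

theorem trace_eq_sum_frameCoeff {x y : M}
    (hy : y ∈ (trivializationAt E (TangentSpace I : M → Type _) x).baseSet)
    (A : TangentSpace I y →ₗ[ℝ] TangentSpace I y) :
    LinearMap.trace ℝ (TangentSpace I y) A = ∑ i, frameCoeff I x i y (A (frame I x i y)) := by
  rw [LinearMap.trace_eq_matrix_trace ℝ
    ((trivializationAt E (TangentSpace I : M → Type _) x).basisAt (Module.finBasis ℝ E) hy)]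
  refine Finset.sum_congr rfl fun i _ ↦ ?_
  rw [Matrix.diag_apply, LinearMap.toMatrix_apply, frameCoeff_apply hy, frame,
    Bundle.Trivialization.localFrame_apply_of_mem_baseSet _ _ hy]

theorem contMDiffAt_mvfderiv {X : Π x : M, TangentSpace I x} {f : M → ℝ} {x : M}
    (hf : CMDiffAt ∞ f x) (hX : CMDiffAt ∞ (T% X) x) :
    CMDiffAt ∞ (fun y ↦ d% f y (X y)) x := by
  have := FiniteDimensional.complete ℝ E
  have hx := mem_baseSet_trivializationAt E (TangentSpace I : M → Type _) x
  rcases subsingleton_or_nontrivial E with hE | hE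
  · refine (contMDiffAt_const (c := (0 : ℝ))).congr_of_eventuallyEq (.of_forall fun y ↦ ?_)
    have : X y = 0 := @Subsingleton.elim E hE _ _
    simp [this]
  · let i : Fin (Module.finrank ℝ E) := ⟨0, Module.finrank_pos⟩
    have hW := contMDiffAt_frame (I := I) hx i
    have h1 := (contMDiffAt_iff_frameCoeff hx).1
      (contMDiffAt_mlieBracket hX (hf.smul_section hW)) i
    have h2 := (contMDiffAt_iff_frameCoeff hx).1 (contMDiffAt_mlieBracket hX hW) i
    refine (h1.sub (hf.mul h2)).congr_of_eventuallyEq ?_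
    filter_upwards [eventually_mdifferentiableAt_fun hf, eventually_mdifferentiableAt hW,
      (trivializationAt E (TangentSpace I : M → Type _) x).open_baseSet.mem_nhds hx]
      with y hy1 hy2 hy3
    have h3 := mlieBracket_smul_right (V := X) hy1 hy2
    change _ = frameCoeff I x i y (mlieBracket I X (f • frame I x i) y) - f y * _
    rw [h3, map_add, map_smul, map_smul, frameCoeff_frame hy3]
    simp

theorem mvfderiv_mlieBracket {X Y : Π x : M, TangentSpace I x} {f : M → ℝ} {x : M}
    (hf : CMDiffAt ∞ f x) (hX : CMDiffAt ∞ (T% X) x) (hY : CMDiffAt ∞ (T% Y) x) :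
    d% f x (mlieBracket I X Y x) =
      d% (fun y ↦ d% f y (Y y)) x (X x) - d% (fun y ↦ d% f y (X y)) x (Y x) := by
  have := FiniteDimensional.complete ℝ E
  have hx := mem_baseSet_trivializationAt E (TangentSpace I : M → Type _) x
  rcases subsingleton_or_nontrivial E with hE | hE
  · have h1 : X x = 0 := @Subsingleton.elim E hE _ _
    have h2 : Y x = 0 := @Subsingleton.elim E hE _ _
    have h3 : mlieBracket I X Y x = 0 := @Subsingleton.elim E hE _ _
    simp [h1, h2, h3]
  · let i : Fin (Module.finrank ℝ E) := ⟨0, Module.finrank_pos⟩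
    have hW := contMDiffAt_frame (I := I) hx i
    have hfW := hf.smul_section hW
    have md : ∀ {Z : Π x : M, TangentSpace I x}, CMDiffAt ∞ (T% Z) x → MDiffAt (T% Z) x :=
      fun h ↦ h.mdifferentiableAt (by simp)
    have mdf : ∀ {f : M → ℝ}, CMDiffAt ∞ f x → MDiffAt f x :=
      fun h ↦ h.mdifferentiableAt (by simp)
    have expand : ∀ {Z : Π x : M, TangentSpace I x}, CMDiffAt ∞ (T% Z) x →
        mlieBracket I Z (f • frame I x i) =ᶠ[𝓝 x]
          (fun y ↦ d% f y (Z y)) • frame I x i + f • mlieBracket I Z (frame I x i) := by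
      intro Z hZ
      filter_upwards [eventually_mdifferentiableAt_fun hf, eventually_mdifferentiableAt hW]
        with y hy1 hy2
      exact mlieBracket_smul_right (V := Z) hy1 hy2
    have double : ∀ {Z Z' : Π x : M, TangentSpace I x}, CMDiffAt ∞ (T% Z) x →
        CMDiffAt ∞ (T% Z') x → mlieBracket I Z (mlieBracket I Z' (f • frame I x i)) x =
          d% (fun y ↦ d% f y (Z' y)) x (Z x) • frame I x i x
            + d% f x (Z' x) • mlieBracket I Z (frame I x i) x
            + d% f x (Z x) • mlieBracket I Z' (frame I x i) x
            + f x • mlieBracket I Z (mlieBracket I Z' (frame I x i)) x := by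
      intro Z Z' hZ hZ'
      have hdf := contMDiffAt_mvfderiv hf hZ'
      have hb := contMDiffAt_mlieBracket hZ' hW
      rw [(Filter.EventuallyEq.refl _ Z).mlieBracket_vectorField_eq (expand hZ'),
        mlieBracket_add_right (md (hdf.smul_section hW)) (md (hf.smul_section hb)),
        mlieBracket_smul_right (mdf hdf) (md hW), mlieBracket_smul_right (mdf hf) (md hb)]
      abel
    have hj := jacobi_mlieBracket hX hY hfW
    have hj0 := jacobi_mlieBracket hX hY hW
    rw [double hX hY, double hY hX, mlieBracket_smul_right (mdf hf) (md hW), hj0] at hj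
    have hj2 := congrArg (frameCoeff I x i x) hj
    simp only [map_add, map_smul, frameCoeff_frame hx, smul_eq_mul, if_true, mul_one] at hj2
    linarith

theorem contMDiffAt_det {ι : Type*} [Fintype ι] [DecidableEq ι] {A : M → Matrix ι ι ℝ} {x : M}
    (hA : ∀ i j, CMDiffAt ∞ (fun y ↦ A y i j) x) : CMDiffAt ∞ (fun y ↦ (A y).det) x := by
  simp only [Matrix.det_apply, Units.smul_def, zsmul_eq_mul]
  exact contMDiffAt_finsetSum fun σ _ ↦
    contMDiffAt_const.mul (contMDiffAt_finsetProd fun i _ ↦ hA _ _)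

namespace PseudoMetric

variable (g : PseudoMetric I M)

theorem contMDiffAt_inner {X Y : Π x : M, TangentSpace I x} {x : M}
    (hX : CMDiffAt ∞ (T% X) x) (hY : CMDiffAt ∞ (T% Y) x) :
    CMDiffAt ∞ (fun y ↦ g.inner y (X y) (Y y)) x := by
  have h : ContMDiffAt I (I.prod 𝓘(ℝ)) ∞ (fun y ↦ TotalSpace.mk' ℝ (E := Bundle.Trivial M ℝ) y
      (g.inner y (X y) (Y y))) x :=
    ContMDiffAt.clm_bundle_apply₂ (F₁ := E) (F₂ := E) (g.contMDiff x) hX hY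
  rw [contMDiffAt_section] at h
  exact h

theorem det_gram_ne_zero {ι : Type*} [Fintype ι] [DecidableEq ι] {x : M}
    (b : Module.Basis ι ℝ (TangentSpace I x)) :
    (Matrix.of fun i j ↦ g.inner x (b i) (b j)).det ≠ 0 := by
  intro h
  obtain ⟨c, hc, h0⟩ := Matrix.exists_mulVec_eq_zero_iff.2 h
  refine hc ?_
  have hs : ∑ j, c j • b j = 0 := by
    refine g.nondegenerate x _ fun w ↦ ?_
    rw [g.symm, ← b.sum_repr w]
    simp only [map_sum (g.inner x), map_smul (g.inner x), sum_apply, smul_apply]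
    refine Finset.sum_eq_zero fun j _ ↦ ?_
    have hj := congrFun h0 j
    simp only [Matrix.mulVec, dotProduct, Matrix.of_apply, Pi.zero_apply] at hj
    rw [map_sum, ← smul_zero (b.repr w j), ← hj]
    simp [mul_comm]
  funext j
  exact Fintype.linearIndependent_iff.1 b.linearIndependent c hs j

/-- Cramer's rule in the frame. -/
theorem contMDiffAt_of_inner_frame {s : Π x : M, TangentSpace I x} {x : M}
    (hs : ∀ i, CMDiffAt ∞ (fun y ↦ g.inner y (s y) (frame I x i y)) x) :
    CMDiffAt ∞ (T% s) x := by
  have hx := mem_baseSet_trivializationAt E (TangentSpace I : M → Type _) x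
  rw [contMDiffAt_iff_frameCoeff hx]
  intro i
  let G : M → Matrix (Fin (Module.finrank ℝ E)) (Fin (Module.finrank ℝ E)) ℝ :=
    fun y ↦ Matrix.of fun i j ↦ g.inner y (frame I x i y) (frame I x j y)
  let u : M → Fin (Module.finrank ℝ E) → ℝ := fun y j ↦ g.inner y (s y) (frame I x j y)
  have hG : ∀ j k, CMDiffAt ∞ (fun y ↦ G y j k) x := fun j k ↦
    g.contMDiffAt_inner (contMDiffAt_frame hx j) (contMDiffAt_frame hx k)
  have hdet : ∀ y ∈ (trivializationAt E (TangentSpace I : M → Type _) x).baseSet,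
      (G y).det ≠ 0 := by
    intro y hy
    have h := g.det_gram_ne_zero
      ((trivializationAt E (TangentSpace I : M → Type _) x).basisAt (Module.finBasis ℝ E) hy)
    simpa only [G, frame, Bundle.Trivialization.localFrame_apply_of_mem_baseSet _ _ hy] using h
  have hc : CMDiffAt ∞ (fun y ↦ ((G y).updateCol i (u y)).det) x := by
    refine contMDiffAt_det fun j k ↦ ?_
    by_cases hk : k = i
    · subst hk
      simpa [Matrix.updateCol_apply] using hs j
    · simpa [Matrix.updateCol_apply, hk] using hG j k
  refine (((contMDiffAt_det hG).inv₀ (hdet x hx)).mul hc).congr_of_eventuallyEq ?_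
  filter_upwards [(trivializationAt E (TangentSpace I : M → Type _) x).open_baseSet.mem_nhds hx]
    with y hy
  have hu : u y = (G y).mulVec fun j ↦ frameCoeff I x j y (s y) := by
    funext k
    simp only [u, G, Matrix.mulVec, dotProduct, Matrix.of_apply]
    conv_lhs => rw [← sum_frameCoeff hy (s y)]
    rw [g.symm]
    simp [mul_comm]
  have h1 : (G y).cramer (u y) i = (G y).det * frameCoeff I x i y (s y) := by
    rw [Matrix.cramer_eq_adjugate_mulVec, hu, Matrix.mulVec_mulVec, Matrix.adjugate_mul,
      Matrix.smul_mulVec, Matrix.one_mulVec]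
    rfl
  rw [Matrix.cramer_apply] at h1
  change _ = (G y).det⁻¹ * ((G y).updateCol i (u y)).det
  rw [h1, inv_mul_cancel_left₀ (hdet y hy)]

theorem contMDiffAt_leviCivita {X Y : Π x : M, TangentSpace I x} {x : M}
    (hX : CMDiffAt ∞ (T% X) x) (hY : CMDiffAt ∞ (T% Y) x) :
    CMDiffAt ∞ (T% (fun y ↦ g.leviCivita Y y (X y))) x := by
  have hx := mem_baseSet_trivializationAt E (TangentSpace I : M → Type _) x
  refine g.contMDiffAt_of_inner_frame fun i ↦ ?_
  have hZ := contMDiffAt_frame (I := I) hx i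
  have hk : CMDiffAt ∞ (fun y ↦ g.koszul Y X (frame I x i) y) x :=
    (((((contMDiffAt_mvfderiv (g.contMDiffAt_inner hY hZ) hX).add
      (contMDiffAt_mvfderiv (g.contMDiffAt_inner hX hZ) hY)).sub
      (contMDiffAt_mvfderiv (g.contMDiffAt_inner hX hY) hZ)).add
      (g.contMDiffAt_inner (contMDiffAt_mlieBracket hX hY) hZ)).sub
      (g.contMDiffAt_inner (contMDiffAt_mlieBracket hX hZ) hY)).sub
      (g.contMDiffAt_inner (contMDiffAt_mlieBracket hY hZ) hX)
  refine ((contMDiffAt_const (c := (1 / 2 : ℝ))).mul hk).congr_of_eventuallyEq ?_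
  filter_upwards [eventually_mdifferentiableAt hX, eventually_mdifferentiableAt hY,
    eventually_mdifferentiableAt hZ] with y hXy hYy hZy
  have h := g.two_inner_lcDeriv hXy hYy hZy
  change g.inner y (g.lcDeriv Y y (X y)) (frame I x i y) = 1 / 2 * g.koszul Y X (frame I x i) y
  linarith

theorem leviCivita_congr {Y Y' : Π x : M, TangentSpace I x} {x : M} (hY : MDiffAt (T% Y) x)
    (h : Y =ᶠ[𝓝 x] Y') : g.leviCivita Y x = g.leviCivita Y' x := by
  have hY' : MDiffAt (T% Y') x :=
    hY.congr_of_eventuallyEq (h.symm.mono fun y hy ↦ by simp [hy])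
  exact g.leviCivita.isCovariantDerivativeOnUniv.congr_of_eventuallyEq hY hY' Filter.univ_mem h

end PseudoMetric

end Smoothness

section Sections

variable {E : Type*} [NormedAddCommGroup E] [NormedSpace ℝ E] [FiniteDimensional ℝ E]
  {H : Type*} [TopologicalSpace H] {I : ModelWithCorners ℝ E H}
  {M : Type*} [TopologicalSpace M] [ChartedSpace H M] [IsManifold I ∞ M]

open scoped Classical in
/-- The extension by zero of a section over an open set. -/
def zeroExt {V : M → Type*} [∀ y, Zero (V y)] (U : TopologicalSpace.Opens M)
    (s : Π y : U, V y) (y : M) : V y :=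
  if h : y ∈ U then s ⟨y, h⟩ else 0

variable {U : TopologicalSpace.Opens M}

theorem zeroExt_of_mem {V : M → Type*} [∀ y, Zero (V y)] (s : Π y : U, V y) {y : M}
    (h : y ∈ U) : zeroExt U s y = s ⟨y, h⟩ :=
  dif_pos h

theorem zeroExt_of_notMem {V : M → Type*} [∀ y, Zero (V y)] (s : Π y : U, V y) {y : M}
    (h : y ∉ U) : zeroExt U s y = 0 :=
  dif_neg h

theorem zeroExt_restrict_eventuallyEq {V : M → Type*} [∀ y, Zero (V y)] (s : Π y, V y) {y : M}
    (hy : y ∈ U) : ∀ᶠ z in 𝓝 y, zeroExt U (fun z : U ↦ s z) z = s z := by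
  filter_upwards [U.2.mem_nhds hy] with z hz using zeroExt_of_mem _ hz

theorem mlieBracket_congr {s s' t t' : Π y : M, TangentSpace I y} {x : M}
    (hs : s =ᶠ[𝓝 x] s') (ht : t =ᶠ[𝓝 x] t') : mlieBracket I s t x = mlieBracket I s' t' x :=
  hs.mlieBracket_vectorField_eq ht

theorem mvfderiv_congr {f f' : M → ℝ} {x : M} (h : f =ᶠ[𝓝 x] f') : d% f x = d% f' x := by
  rw [mvfderiv, mvfderiv, h.mfderiv_eq]
  rfl

theorem contMDiffAt_congr_section {s t : Π y : M, TangentSpace I y} {x : M}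
    (hs : CMDiffAt ∞ (T% s) x) (h : t =ᶠ[𝓝 x] s) : CMDiffAt ∞ (T% t) x :=
  hs.congr_of_eventuallyEq (h.mono fun y hy ↦ by simp [hy])

theorem zeroExt_add (s t : Π y : U, TangentSpace I (y : M)) :
    zeroExt U (s + t) = zeroExt U s + zeroExt U t := by
  funext y
  by_cases h : y ∈ U
  · simp only [Pi.add_apply, zeroExt_of_mem _ h]
  · simp only [Pi.add_apply, zeroExt_of_notMem _ h]
    exact (add_zero _).symm

theorem zeroExt_smul (f : U → ℝ) (s : Π y : U, TangentSpace I (y : M)) :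
    zeroExt U (fun y ↦ f y • s y) = zeroExt (V := fun _ ↦ ℝ) U f • zeroExt U s := by
  funext y
  by_cases h : y ∈ U
  · simp only [Pi.smul_apply', zeroExt_of_mem _ h]
  · simp only [Pi.smul_apply', zeroExt_of_notMem _ h]
    exact (zero_smul ℝ _).symm

variable (I U) in
/-- The algebra of smooth functions on an open set. -/
def smoothFunctions : Subalgebra ℝ (U → ℝ) where
  carrier := {f | ∀ y ∈ U, CMDiffAt ∞ (zeroExt (V := fun _ ↦ ℝ) U f) y}
  mul_mem' {f f'} hf hf' y hy := ((hf y hy).mul (hf' y hy)).congr_of_eventuallyEq <|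
    .of_forall fun z ↦ by by_cases h : z ∈ U <;> simp [zeroExt, h]
  add_mem' {f f'} hf hf' y hy := ((hf y hy).add (hf' y hy)).congr_of_eventuallyEq <|
    .of_forall fun z ↦ by by_cases h : z ∈ U <;> simp [zeroExt, h]
  algebraMap_mem' r y hy := (contMDiffAt_const (c := r)).congr_of_eventuallyEq
    (zeroExt_restrict_eventuallyEq (V := fun _ ↦ ℝ) (fun _ ↦ r) hy)

variable (I U) in
/-- The module of smooth vector fields on an open set. -/
def smoothFields : Submodule (smoothFunctions I U) (Π y : U, TangentSpace I (y : M)) where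
  carrier := {s | ∀ y ∈ U, CMDiffAt ∞ (T% (zeroExt U s)) y}
  add_mem' {s t} hs ht y hy := by
    rw [zeroExt_add]
    exact (hs y hy).add_section (ht y hy)
  zero_mem' y hy := by
    refine contMDiffAt_congr_section (s := 0) (contMDiff_zeroSection ℝ _ y) <| .of_forall fun z ↦ ?_
    by_cases h : z ∈ U
    · exact zeroExt_of_mem _ h
    · exact zeroExt_of_notMem _ h
  smul_mem' f s hs y hy := by
    rw [show f • s = fun y ↦ f.1 y • s y from rfl, zeroExt_smul]
    exact (f.2 y hy).smul_section (hs y hy)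

variable (I U) in
/-- The type of smooth functions on an open set. -/
def SmoothFunction : Type _ := smoothFunctions I U

variable (I U) in
/-- The type of smooth vector fields on an open set. -/
def SmoothField : Type _ := smoothFields I U

instance : CommRing (SmoothFunction I U) := inferInstanceAs (CommRing (smoothFunctions I U))

instance : Algebra ℝ (SmoothFunction I U) := inferInstanceAs (Algebra ℝ (smoothFunctions I U))

instance : AddCommGroup (SmoothField I U) := inferInstanceAs (AddCommGroup (smoothFields I U))

instance : Module (SmoothFunction I U) (SmoothField I U) :=
  inferInstanceAs (Module (smoothFunctions I U) (smoothFields I U))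

/-- The extension by zero of a smooth function. -/
def fext (f : SmoothFunction I U) : M → ℝ := zeroExt (V := fun _ ↦ ℝ) U f.1

/-- The extension by zero of a smooth vector field. -/
def vext (s : SmoothField I U) : Π y : M, TangentSpace I y := zeroExt U s.1

theorem fext_apply (f : SmoothFunction I U) (y : U) : fext f y = f.1 y := zeroExt_of_mem _ y.2

theorem vext_apply (s : SmoothField I U) (y : U) : vext s y = s.1 y := zeroExt_of_mem _ y.2

theorem contMDiffAt_fext (f : SmoothFunction I U) {y : M} (hy : y ∈ U) :
    CMDiffAt ∞ (fext f) y := f.2 y hy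

theorem contMDiffAt_vext (s : SmoothField I U) {y : M} (hy : y ∈ U) :
    CMDiffAt ∞ (T% (vext s)) y := s.2 y hy

theorem mdifferentiableAt_fext (f : SmoothFunction I U) {y : M} (hy : y ∈ U) :
    MDiffAt (fext f) y := (f.2 y hy).mdifferentiableAt (by simp)

theorem mdifferentiableAt_vext (s : SmoothField I U) {y : M} (hy : y ∈ U) :
    MDiffAt (T% (vext s)) y := (s.2 y hy).mdifferentiableAt (by simp)

theorem fext_add (f f' : SmoothFunction I U) : fext (f + f') = fext f + fext f' := by
  funext y
  by_cases h : y ∈ U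
  · simp [fext, zeroExt, h]; rfl
  · simp [fext, zeroExt, h]

theorem fext_mul (f f' : SmoothFunction I U) : fext (f * f') = fext f * fext f' := by
  funext y
  by_cases h : y ∈ U
  · simp [fext, zeroExt, h]; rfl
  · simp [fext, zeroExt, h]

theorem fext_smul (r : ℝ) (f : SmoothFunction I U) : fext (r • f) = (fun _ ↦ r) * fext f := by
  funext y
  by_cases h : y ∈ U
  · simp [fext, zeroExt, h]; rfl
  · simp [fext, zeroExt, h]

theorem vext_add (s t : SmoothField I U) : vext (s + t) = vext s + vext t := zeroExt_add _ _

theorem vext_smul (f : SmoothFunction I U) (s : SmoothField I U) :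
    vext (f • s) = fext f • vext s := zeroExt_smul _ _

/-- The restriction of a function which is smooth on an open set. -/
def mkFun (F : M → ℝ) (hF : ∀ y ∈ U, CMDiffAt ∞ F y) : SmoothFunction I U :=
  ⟨fun y ↦ F y, fun y hy ↦ (hF y hy).congr_of_eventuallyEq
    (zeroExt_restrict_eventuallyEq (V := fun _ ↦ ℝ) F hy)⟩

/-- The restriction of a vector field which is smooth on an open set. -/
def mkField (F : Π y : M, TangentSpace I y) (hF : ∀ y ∈ U, CMDiffAt ∞ (T% F) y) :
    SmoothField I U :=
  ⟨fun y ↦ F y, fun y hy ↦ contMDiffAt_congr_section (hF y hy)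
    (zeroExt_restrict_eventuallyEq F hy)⟩

theorem fext_mkFun (F : M → ℝ) (hF : ∀ y ∈ U, CMDiffAt ∞ F y) {y : M} (hy : y ∈ U) :
    fext (mkFun (I := I) F hF) =ᶠ[𝓝 y] F :=
  zeroExt_restrict_eventuallyEq (V := fun _ ↦ ℝ) F hy

theorem vext_mkField (F : Π y : M, TangentSpace I y) (hF : ∀ y ∈ U, CMDiffAt ∞ (T% F) y) {y : M}
    (hy : y ∈ U) : vext (mkField F hF) =ᶠ[𝓝 y] F :=
  zeroExt_restrict_eventuallyEq F hy

theorem SmoothFunction.ext {f f' : SmoothFunction I U} (h : ∀ y ∈ U, fext f y = fext f' y) :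
    f = f' :=
  Subtype.ext <| funext fun y ↦ by rw [← fext_apply, ← fext_apply, h y y.2]

theorem SmoothField.ext {s t : SmoothField I U} (h : ∀ y ∈ U, vext s y = vext t y) :
    s = t :=
  Subtype.ext <| funext fun y ↦ by rw [← vext_apply, ← vext_apply, h y y.2]

variable (I U) in
/-- The derivative of a function along a vector field. -/
def fieldDerivation (s : SmoothField I U) :
    Derivation ℝ (SmoothFunction I U) (SmoothFunction I U) :=
  Derivation.mk'
    { toFun := fun f ↦ mkFun (fun y ↦ d% (fext f) y (vext s y)) fun _ hy ↦
        contMDiffAt_mvfderiv (contMDiffAt_fext f hy) (contMDiffAt_vext s hy)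
      map_add' := fun f f' ↦ Subtype.ext <| funext fun y ↦ by
        change d% (fext (f + f')) y (vext s y) =
          d% (fext f) y (vext s y) + d% (fext f') y (vext s y)
        rw [fext_add, mvfderiv_add (mdifferentiableAt_fext f y.2) (mdifferentiableAt_fext f' y.2)]
        rfl
      map_smul' := fun r f ↦ Subtype.ext <| funext fun y ↦ by
        change d% (fext (r • f)) y (vext s y) = r * d% (fext f) y (vext s y)
        rw [fext_smul, mvfderiv_mul mdifferentiableAt_const (mdifferentiableAt_fext f y.2),
          mvfderiv_const]
        simp [fext_apply] }
    fun f f' ↦ Subtype.ext <| funext fun y ↦ by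
      change d% (fext (f * f')) y (vext s y) =
        f.1 y * d% (fext f') y (vext s y) + f'.1 y * d% (fext f) y (vext s y)
      rw [fext_mul, mvfderiv_mul (mdifferentiableAt_fext f y.2) (mdifferentiableAt_fext f' y.2),
        ← fext_apply, ← fext_apply]
      rfl

theorem fieldDerivation_apply (s : SmoothField I U) (f : SmoothFunction I U) :
    fieldDerivation I U s f = mkFun (fun y ↦ d% (fext f) y (vext s y)) fun _ hy ↦
        contMDiffAt_mvfderiv (contMDiffAt_fext f hy) (contMDiffAt_vext s hy) := rfl

/-- The Lie bracket of smooth vector fields on an open set. -/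
def fieldBracket (s t : SmoothField I U) : SmoothField I U :=
  mkField (mlieBracket I (vext s) (vext t)) fun _ hy ↦
    contMDiffAt_mlieBracket (contMDiffAt_vext s hy) (contMDiffAt_vext t hy)

variable (I U) in
/-- The smooth functions and vector fields on an open set. -/
def fieldAlgebra : FieldAlgebra (SmoothFunction I U) (SmoothField I U) where
  act :=
    { toFun := fieldDerivation I U
      map_add' := fun s t ↦ Derivation.ext fun f ↦ Subtype.ext <| funext fun y ↦ by
        change d% (fext f) y (vext (s + t) y) =
          d% (fext f) y (vext s y) + d% (fext f) y (vext t y)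
        rw [vext_add, Pi.add_apply, map_add]
      map_smul' := fun f s ↦ Derivation.ext fun f' ↦ Subtype.ext <| funext fun y ↦ by
        change d% (fext f') y (vext (f • s) y) = f.1 y * d% (fext f') y (vext s y)
        rw [vext_smul, Pi.smul_apply', map_smul, fext_apply]
        rfl }
  br := AddMonoidHom.mk' (fun s ↦ AddMonoidHom.mk' (fieldBracket s) fun t t' ↦ by
      refine Subtype.ext <| funext fun y ↦ ?_
      change mlieBracket I (vext s) (vext (t + t')) y =
        mlieBracket I (vext s) (vext t) y + mlieBracket I (vext s) (vext t') y
      rw [vext_add, mlieBracket_add_right (mdifferentiableAt_vext t y.2)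
        (mdifferentiableAt_vext t' y.2)]) fun s s' ↦ by
      refine AddMonoidHom.ext fun t ↦ Subtype.ext <| funext fun y ↦ ?_
      change mlieBracket I (vext (s + s')) (vext t) y =
        mlieBracket I (vext s) (vext t) y + mlieBracket I (vext s') (vext t) y
      rw [vext_add, mlieBracket_add_left (mdifferentiableAt_vext s y.2)
        (mdifferentiableAt_vext s' y.2)]
  br_self s := Subtype.ext <| funext fun y ↦ by
    change mlieBracket I (vext s) (vext s) y = 0
    rw [mlieBracket_self]
    rfl
  br_smul s f t := Subtype.ext <| funext fun y ↦ by
    change mlieBracket I (vext s) (vext (f • t)) y =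
      f.1 y • mlieBracket I (vext s) (vext t) y + d% (fext f) y (vext s y) • t.1 y
    rw [vext_smul, mlieBracket_smul_right (mdifferentiableAt_fext f y.2)
      (mdifferentiableAt_vext t y.2), add_comm, fext_apply, vext_apply t]
  jacobi s t u := Subtype.ext <| funext fun y ↦ by
    change mlieBracket I (vext s) (vext (fieldBracket t u)) y =
      mlieBracket I (vext (fieldBracket s t)) (vext u) y
        + mlieBracket I (vext t) (vext (fieldBracket s u)) y
    have h (s t : SmoothField I U) := vext_mkField (mlieBracket I (vext s) (vext t)) (fun _ hy ↦
      contMDiffAt_mlieBracket (contMDiffAt_vext s hy) (contMDiffAt_vext t hy)) y.2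
    change _ = mlieBracket I (vext (mkField _ _)) (vext u) y
      + mlieBracket I (vext t) (vext (mkField _ _)) y
    rw [fieldBracket, mlieBracket_congr (.refl _ (vext s)) (h t u),
      mlieBracket_congr (h s t) (.refl _ (vext u)), mlieBracket_congr (.refl _ (vext t)) (h s u)]
    exact jacobi_mlieBracket (contMDiffAt_vext s y.2) (contMDiffAt_vext t y.2)
      (contMDiffAt_vext u y.2)
  act_br s t f := Subtype.ext <| funext fun y ↦ by
    change d% (fext f) y (vext (fieldBracket s t) y) =
      d% (fext (fieldDerivation I U t f)) y (vext s y)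
        - d% (fext (fieldDerivation I U s f)) y (vext t y)
    have h (s : SmoothField I U) := fext_mkFun (I := I) (fun y ↦ d% (fext f) y (vext s y))
      (fun _ hy ↦ contMDiffAt_mvfderiv (contMDiffAt_fext f hy) (contMDiffAt_vext s hy)) y.2
    rw [fieldDerivation_apply, fieldDerivation_apply, mvfderiv_congr (h s),
      mvfderiv_congr (h t), vext_apply]
    exact mvfderiv_mlieBracket (contMDiffAt_fext f y.2) (contMDiffAt_vext s y.2)
      (contMDiffAt_vext t y.2)

theorem fext_act (s : SmoothField I U) (f : SmoothFunction I U) {y : M} (hy : y ∈ U) :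
    fext ((fieldAlgebra I U).act s f) y = d% (fext f) y (vext s y) :=
  (fext_mkFun _ _ hy).self_of_nhds

theorem vext_br (s t : SmoothField I U) {y : M} (hy : y ∈ U) :
    vext ((fieldAlgebra I U).br s t) =ᶠ[𝓝 y] mlieBracket I (vext s) (vext t) :=
  vext_mkField (mlieBracket I (vext s) (vext t)) (fun _ hy ↦
    contMDiffAt_mlieBracket (contMDiffAt_vext s hy) (contMDiffAt_vext t hy)) hy

end Sections

section Frames

variable {E : Type*} [NormedAddCommGroup E] [NormedSpace ℝ E] [FiniteDimensional ℝ E]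
  {H : Type*} [TopologicalSpace H] {I : ModelWithCorners ℝ E H}
  {M : Type*} [TopologicalSpace M] [ChartedSpace H M] [IsManifold I ∞ M]
  {U : TopologicalSpace.Opens M}

/-- Evaluation of the extension of a vector field. -/
def vextHom (y : M) : SmoothField I U →+ TangentSpace I y :=
  AddMonoidHom.mk' (fun s ↦ vext s y) fun s t ↦ by rw [vext_add]; rfl

/-- Evaluation of the extension of a function. -/
def fextHom (y : M) : SmoothFunction I U →+ ℝ :=
  AddMonoidHom.mk' (fun f ↦ fext f y) fun f f' ↦ by rw [fext_add]; rfl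

theorem vext_sum {ι : Type*} (S : Finset ι) (s : ι → SmoothField I U) (y : M) :
    vext (∑ i ∈ S, s i) y = ∑ i ∈ S, vext (s i) y :=
  map_sum (vextHom y) s S

theorem fext_sum {ι : Type*} (S : Finset ι) (f : ι → SmoothFunction I U) (y : M) :
    fext (∑ i ∈ S, f i) y = ∑ i ∈ S, fext (f i) y :=
  map_sum (fextHom y) f S

theorem vext_sub (s t : SmoothField I U) (y : M) : vext (s - t) y = vext s y - vext t y :=
  map_sub (vextHom y) s t

theorem vext_neg (s : SmoothField I U) (y : M) : vext (-s) y = -vext s y :=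
  map_neg (vextHom y) s

theorem vext_zero (y : M) : vext (0 : SmoothField I U) y = 0 :=
  map_zero (vextHom y)

theorem fext_sub (f f' : SmoothFunction I U) (y : M) : fext (f - f') y = fext f y - fext f' y :=
  map_sub (fextHom y) f f'

theorem fext_neg (f : SmoothFunction I U) (y : M) : fext (-f) y = -fext f y :=
  map_neg (fextHom y) f

theorem fext_zero (y : M) : fext (0 : SmoothFunction I U) y = 0 :=
  map_zero (fextHom y)

theorem fext_algebraMap (r : ℝ) {y : M} (hy : y ∈ U) :
    fext (algebraMap ℝ (SmoothFunction I U) r) y = r :=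
  fext_apply _ ⟨y, hy⟩

theorem fext_one {y : M} (hy : y ∈ U) : fext (1 : SmoothFunction I U) y = 1 :=
  fext_apply _ ⟨y, hy⟩

theorem mkFun_apply (F : M → ℝ) (hF : ∀ y ∈ U, CMDiffAt ∞ F y) {y : M} (hy : y ∈ U) :
    fext (mkFun (I := I) F hF) y = F y :=
  (fext_mkFun F hF hy).self_of_nhds

theorem mkField_apply (F : Π y : M, TangentSpace I y) (hF : ∀ y ∈ U, CMDiffAt ∞ (T% F) y) {y : M}
    (hy : y ∈ U) : vext (mkField F hF) y = F y :=
  (vext_mkField F hF hy).self_of_nhds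

variable {x₀ : M} (hU : ∀ y ∈ U, y ∈ (trivializationAt E (TangentSpace I : M → Type _) x₀).baseSet)

/-- The frame on an open subset of the domain of a chart. -/
def frameField (i : Fin (Module.finrank ℝ E)) : SmoothField I U :=
  mkField (frame I x₀ i) fun y hy ↦ contMDiffAt_frame (hU y hy) i

/-- The coordinates of vector fields in the frame. -/
def frameEquiv : SmoothField I U ≃ₗ[SmoothFunction I U]
    (Fin (Module.finrank ℝ E) → SmoothFunction I U) where
  toFun s i := mkFun (fun y ↦ frameCoeff I x₀ i y (vext s y)) fun y hy ↦
    (contMDiffAt_iff_frameCoeff (hU y hy)).1 (contMDiffAt_vext s hy) i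
  map_add' s t := funext fun i ↦ SmoothFunction.ext fun y hy ↦ by
    rw [mkFun_apply _ _ hy, Pi.add_apply, fext_add, Pi.add_apply, mkFun_apply _ _ hy,
      mkFun_apply _ _ hy, vext_add, Pi.add_apply, map_add]
  map_smul' f s := funext fun i ↦ SmoothFunction.ext fun y hy ↦ by
    rw [mkFun_apply _ _ hy, Pi.smul_apply, smul_eq_mul, RingHom.id_apply, fext_mul, Pi.mul_apply,
      mkFun_apply _ _ hy, vext_smul, Pi.smul_apply', map_smul, smul_eq_mul]
  invFun c := ∑ i, c i • frameField hU i
  left_inv s := SmoothField.ext fun y hy ↦ by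
    rw [vext_sum, ← sum_frameCoeff (hU y hy) (vext s y)]
    refine Finset.sum_congr rfl fun i _ ↦ ?_
    rw [vext_smul, Pi.smul_apply', mkFun_apply _ _ hy, frameField, mkField_apply _ _ hy]
  right_inv c := funext fun i ↦ SmoothFunction.ext fun y hy ↦ by
    rw [mkFun_apply _ _ hy, vext_sum, map_sum, Finset.sum_eq_single i]
    · rw [vext_smul, Pi.smul_apply', frameField, mkField_apply _ _ hy, map_smul,
        frameCoeff_frame (hU y hy), if_pos rfl, smul_eq_mul, mul_one]
    · intro j _ hj
      rw [vext_smul, Pi.smul_apply', frameField, mkField_apply _ _ hy, map_smul,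
        frameCoeff_frame (hU y hy), if_neg hj, smul_zero]
    · simp

/-- The frame as a basis of the module of vector fields. -/
def frameBasis : Module.Basis (Fin (Module.finrank ℝ E)) (SmoothFunction I U) (SmoothField I U) :=
  Module.Basis.ofEquivFun (frameEquiv hU)

theorem frameBasis_apply (i : Fin (Module.finrank ℝ E)) {y : M} (hy : y ∈ U) :
    vext (frameBasis hU i) y = frame I x₀ i y := by
  have h : frameBasis hU i = ∑ j, (Pi.single i 1 : _ → SmoothFunction I U) j • frameField hU j := by
    rw [frameBasis, Module.Basis.coe_ofEquivFun]
    rfl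
  rw [h, Finset.sum_eq_single i]
  · rw [Pi.single_eq_same, one_smul, frameField, mkField_apply _ _ hy]
  · intro j _ hj
    rw [Pi.single_eq_of_ne hj, zero_smul]
  · simp

theorem frameBasis_repr (s : SmoothField I U) (i : Fin (Module.finrank ℝ E)) {y : M}
    (hy : y ∈ U) : fext ((frameBasis hU).repr s i) y = frameCoeff I x₀ i y (vext s y) :=
  mkFun_apply _ _ hy

include hU

theorem free_smoothField : Module.Free (SmoothFunction I U) (SmoothField I U) :=
  .of_basis (frameBasis hU)

theorem finite_smoothField : Module.Finite (SmoothFunction I U) (SmoothField I U) :=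
  .of_basis (frameBasis hU)

theorem trace_apply (A : SmoothField I U →ₗ[SmoothFunction I U] SmoothField I U) {y : M}
    (hy : y ∈ U) (a : TangentSpace I y →ₗ[ℝ] TangentSpace I y)
    (ha : ∀ s, vext (A s) y = a (vext s y)) :
    fext (LinearMap.trace _ _ A) y = LinearMap.trace ℝ (TangentSpace I y) a := by
  rw [LinearMap.trace_eq_matrix_trace _ (frameBasis hU), Matrix.trace, fext_sum,
    trace_eq_sum_frameCoeff (hU y hy)]
  refine Finset.sum_congr rfl fun i _ ↦ ?_
  rw [Matrix.diag_apply, LinearMap.toMatrix_apply, frameBasis_repr _ _ _ hy, ha,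
    frameBasis_apply _ _ hy]

theorem trace_id : LinearMap.trace (SmoothFunction I U) (SmoothField I U) LinearMap.id =
    algebraMap ℝ _ (Module.finrank ℝ E : ℝ) :=
  SmoothFunction.ext fun y hy ↦ by
    have : Module.Finite ℝ (TangentSpace I y) := inferInstanceAs (Module.Finite ℝ E)
    rw [trace_apply hU LinearMap.id hy LinearMap.id fun _ ↦ rfl, LinearMap.trace_id,
      fext_algebraMap _ hy]
    rfl

theorem vext_apply_congr (A : SmoothField I U →ₗ[SmoothFunction I U] SmoothField I U) {y : M}
    (hy : y ∈ U) {s t : SmoothField I U} (hst : vext s y = vext t y) :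
    vext (A s) y = vext (A t) y := by
  have h : ∀ s, vext (A s) y = ∑ i, frameCoeff I x₀ i y (vext s y) • vext (A (frameBasis hU i)) y := by
    intro s
    conv_lhs => rw [← (frameBasis hU).sum_repr s]
    rw [map_sum, vext_sum]
    refine Finset.sum_congr rfl fun i _ ↦ ?_
    rw [map_smul, vext_smul, Pi.smul_apply', frameBasis_repr _ _ _ hy]
  rw [h s, h t, hst]

omit hU in
/-- The vector field on `U` with constant coordinates and a given value at a point. -/
def constField (y : M) (a : TangentSpace I y) : SmoothField I U :=
  mkField (fun z ↦ ∑ i, frameCoeff I x₀ i y a • frame I x₀ i z) fun z hz ↦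
    ContMDiffAt.sum_section fun i _ ↦ contMDiffAt_const.smul_section (contMDiffAt_frame (hU z hz) i)

theorem constField_apply {y : M} (hy : y ∈ U) (a : TangentSpace I y) :
    vext (constField hU y a) y = a := by
  rw [constField, mkField_apply _ _ hy, sum_frameCoeff (hU y hy)]

end Frames

section Connection

variable {E : Type*} [NormedAddCommGroup E] [NormedSpace ℝ E] [FiniteDimensional ℝ E]
  {H : Type*} [TopologicalSpace H] {I : ModelWithCorners ℝ E H}
  {M : Type*} [TopologicalSpace M] [ChartedSpace H M] [IsManifold I ∞ M]
  {U : TopologicalSpace.Opens M}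

theorem contMDiffAt_extend_of_mem {x y : M} (a : TangentSpace I x)
    (hy : y ∈ (trivializationAt E (TangentSpace I : M → Type _) x).baseSet) :
    CMDiffAt ∞ (T% (extend E a)) y := by
  set t := trivializationAt E (TangentSpace I : M → Type _) x
  have h : CMDiff[t.baseSet] ∞ (T% (extend E a)) := by
    intro z hz
    rw [t.contMDiffWithinAt_section _ hz]
    have ht : ∀ z ∈ t.baseSet, (t ⟨z, extend E a z⟩).2 = (t ⟨x, a⟩).2 := fun z hz ↦ by
      change (t ⟨z, t.symm z (t ⟨x, a⟩).2⟩).2 = _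
      rw [t.apply_mk_symm hz]
    exact contMDiffWithinAt_const.congr ht (ht z hz)
  exact h.contMDiffAt (t.open_baseSet.mem_nhds hy)

namespace PseudoMetric

variable (g : PseudoMetric I M)

theorem leviCivita_add {Y Y' : Π x : M, TangentSpace I x} {x : M} (hY : MDiffAt (T% Y) x)
    (hY' : MDiffAt (T% Y') x) : g.leviCivita (Y + Y') x = g.leviCivita Y x + g.leviCivita Y' x :=
  g.leviCivita.isCovariantDerivativeOnUniv.add hY hY' (Set.mem_univ x)

theorem leviCivita_smul {Y : Π x : M, TangentSpace I x} {f : M → ℝ} {x : M}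
    (hf : MDiffAt f x) (hY : MDiffAt (T% Y) x) (a : TangentSpace I x) :
    g.leviCivita (f • Y) x a = f x • g.leviCivita Y x a + d% f x a • Y x := by
  rw [g.leviCivita.isCovariantDerivativeOnUniv.leibniz hY hf (Set.mem_univ x)]
  rfl

/-- The Levi-Civita derivative of smooth vector fields on an open set. -/
def covField (s t : SmoothField I U) : SmoothField I U :=
  mkField (fun y ↦ g.leviCivita (vext t) y (vext s y)) fun _ hy ↦
    g.contMDiffAt_leviCivita (contMDiffAt_vext s hy) (contMDiffAt_vext t hy)

theorem covField_apply (s t : SmoothField I U) {y : M} (hy : y ∈ U) :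
    vext (g.covField s t) y = g.leviCivita (vext t) y (vext s y) :=
  mkField_apply _ _ hy

variable (U) in
/-- The Levi-Civita connection on the vector fields on an open set. -/
def connection : SymmConnection (fieldAlgebra I U) where
  nab := AddMonoidHom.mk' (fun s ↦ AddMonoidHom.mk' (g.covField s) fun t t' ↦
      SmoothField.ext fun y hy ↦ by
        rw [vext_add, Pi.add_apply, g.covField_apply _ _ hy, g.covField_apply _ _ hy,
          g.covField_apply _ _ hy, vext_add,
          g.leviCivita_add (mdifferentiableAt_vext t hy) (mdifferentiableAt_vext t' hy)]
        rfl) fun s s' ↦ AddMonoidHom.ext fun t ↦ SmoothField.ext fun y hy ↦ by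
      change vext (g.covField (s + s') t) y = vext (g.covField s t + g.covField s' t) y
      rw [vext_add, Pi.add_apply, g.covField_apply _ _ hy, g.covField_apply _ _ hy,
        g.covField_apply _ _ hy, vext_add, Pi.add_apply, map_add]
  smul_nab f s t := SmoothField.ext fun y hy ↦ by
    change vext (g.covField (f • s) t) y = vext (f • g.covField s t) y
    rw [vext_smul, Pi.smul_apply', g.covField_apply _ _ hy, g.covField_apply _ _ hy,
      vext_smul, Pi.smul_apply', map_smul]
  nab_smul s f t := SmoothField.ext fun y hy ↦ by
    change vext (g.covField s (f • t)) y
      = vext (f • g.covField s t + (fieldAlgebra I U).act s f • t) y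
    rw [vext_add, Pi.add_apply, vext_smul, vext_smul, Pi.smul_apply', Pi.smul_apply',
      g.covField_apply _ _ hy, g.covField_apply _ _ hy, vext_smul,
      g.leviCivita_smul (mdifferentiableAt_fext f hy) (mdifferentiableAt_vext t hy),
      fext_act _ _ hy]
  torsion s t := SmoothField.ext fun y hy ↦ by
    change vext (g.covField s t - g.covField t s) y = _
    rw [vext_sub, g.covField_apply _ _ hy, g.covField_apply _ _ hy,
      (vext_br s t hy).self_of_nhds]
    exact ((CovariantDerivative.torsion_eq_zero_iff _).1 g.leviCivita_torsion
      (mdifferentiableAt_vext s hy) (mdifferentiableAt_vext t hy))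

theorem nab_apply (s t : SmoothField I U) {y : M} (hy : y ∈ U) :
    vext ((g.connection U).nab s t) y = g.leviCivita (vext t) y (vext s y) :=
  g.covField_apply s t hy

theorem vext_connection (s t : SmoothField I U) {y : M} (hy : y ∈ U) :
    vext ((g.connection U).nab s t) =ᶠ[𝓝 y] fun z ↦ g.leviCivita (vext t) z (vext s z) :=
  vext_mkField (fun z ↦ g.leviCivita (vext t) z (vext s z)) (fun _ hy ↦
    g.contMDiffAt_leviCivita (contMDiffAt_vext s hy) (contMDiffAt_vext t hy)) hy

theorem curvatureField_eq {X Y Z : Π x : M, TangentSpace I x}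
    (hX : ∀ y ∈ U, CMDiffAt ∞ (T% X) y) (hY : ∀ y ∈ U, CMDiffAt ∞ (T% Y) y)
    (hZ : ∀ y ∈ U, CMDiffAt ∞ (T% Z) y) {y : M} (hy : y ∈ U) :
    g.curvatureField X Y Z y =
      vext ((g.connection U).curv (mkField X hX) (mkField Y hY) (mkField Z hZ)) y := by
  have second : ∀ {V : Π x : M, TangentSpace I x} (hV : ∀ y ∈ U, CMDiffAt ∞ (T% V) y),
      vext ((g.connection U).nab (mkField V hV) (mkField Z hZ)) =ᶠ[𝓝 y]
        fun z ↦ g.leviCivita Z z (V z) := by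
    intro V hV
    filter_upwards [g.vext_connection (mkField V hV) (mkField Z hZ) hy, U.2.mem_nhds hy]
      with z hz hzU
    rw [hz, g.leviCivita_congr (mdifferentiableAt_vext _ hzU) (vext_mkField Z hZ hzU),
      mkField_apply _ _ hzU]
  rw [SymmConnection.curv_apply, vext_sub, vext_sub, g.nab_apply _ _ hy,
    g.nab_apply _ _ hy, g.nab_apply _ _ hy,
    g.leviCivita_congr (mdifferentiableAt_vext _ hy) (second hX),
    g.leviCivita_congr (mdifferentiableAt_vext _ hy) (second hY),
    g.leviCivita_congr (mdifferentiableAt_vext _ hy) (vext_mkField Z hZ hy),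
    (vext_br _ _ hy).self_of_nhds, mlieBracket_congr (vext_mkField X hX hy) (vext_mkField Y hY hy),
    mkField_apply _ _ hy, mkField_apply _ _ hy]
  rfl

theorem curv_congr {x₀ : M}
    (hU : ∀ y ∈ U, y ∈ (trivializationAt E (TangentSpace I : M → Type _) x₀).baseSet) {y : M}
    (hy : y ∈ U) {s s' t t' u u' : SmoothField I U} (hs : vext s y = vext s' y)
    (ht : vext t y = vext t' y) (hu : vext u y = vext u' y) :
    vext ((g.connection U).curv s t u) y = vext ((g.connection U).curv s' t' u') y := by
  rw [vext_apply_congr hU ((g.connection U).curv s t) hy hu]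
  refine (vext_apply_congr hU (((g.connection U).curv s).flip u') hy ht).trans ?_
  exact vext_apply_congr hU (((g.connection U).curv.flip t').flip u') hy hs

theorem vext_curv (s t u : SmoothField I U) {y : M} (hy : y ∈ U) :
    vext ((g.connection U).curv s t u) y = g.curvature y (vext s y) (vext t y) (vext u y) := by
  let T := trivializationAt E (TangentSpace I : M → Type _) y
  let W : TopologicalSpace.Opens M := U ⊓ ⟨T.baseSet, T.open_baseSet⟩
  have hW : ∀ z ∈ W, z ∈ T.baseSet := fun z hz ↦ hz.2
  have hyW : y ∈ W := ⟨hy, mem_baseSet_trivializationAt E _ y⟩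
  have hX : ∀ (s : SmoothField I U), ∀ z ∈ W, CMDiffAt ∞ (T% (vext s)) z :=
    fun s z hz ↦ contMDiffAt_vext s hz.1
  have hE : ∀ (a : TangentSpace I y), ∀ z ∈ W, CMDiffAt ∞ (T% (extend E a)) z :=
    fun a z hz ↦ contMDiffAt_extend_of_mem a hz.2
  have h1 := g.curvatureField_eq (U := U) (fun z hz ↦ contMDiffAt_vext s hz)
    (fun z hz ↦ contMDiffAt_vext t hz) (fun z hz ↦ contMDiffAt_vext u hz) hy
  have h2 := g.curvatureField_eq (U := W) (hX s) (hX t) (hX u) hyW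
  have h3 := g.curvatureField_eq (U := W) (hE (vext s y)) (hE (vext t y)) (hE (vext u y)) hyW
  have mk : ∀ s : SmoothField I U, mkField (vext s) (fun z hz ↦ contMDiffAt_vext s hz) = s :=
    fun s ↦ SmoothField.ext fun z hz ↦ mkField_apply _ _ hz
  rw [mk, mk, mk] at h1
  rw [curvature, h3, ← h1, h2]
  refine g.curv_congr hW hyW ?_ ?_ ?_ <;>
    rw [mkField_apply _ _ hyW, mkField_apply _ _ hyW, extend_apply_self]

end PseudoMetric

end Connection

theorem trace_eq_zero_of_cube_eq_neg {V : Type*} [AddCommGroup V] [Module ℝ V]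
    [FiniteDimensional ℝ V] (A : V →ₗ[ℝ] V) (h : ∀ a, A (A (A a)) = -A a) :
    LinearMap.trace ℝ V A = 0 := by
  let b := Module.finBasis ℝ V
  rw [LinearMap.trace_eq_matrix_trace ℝ b]
  set Q := LinearMap.toMatrix b b A with hQ
  have hQ3 : Q * (Q * Q) = -Q := by
    rw [hQ, ← LinearMap.toMatrix_mul, ← LinearMap.toMatrix_mul, ← map_neg]
    exact congrArg _ (LinearMap.ext h)
  have hC3 : Q.map (algebraMap ℝ ℂ) * (Q.map (algebraMap ℝ ℂ) * Q.map (algebraMap ℝ ℂ)) =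
      -Q.map (algebraMap ℝ ℂ) := by
    rw [← Matrix.map_mul, ← Matrix.map_mul, hQ3]
    ext i j
    simp
  have htr : (algebraMap ℝ ℂ Q.trace) = (Q.map (algebraMap ℝ ℂ)).trace := by
    simp [Matrix.trace]
  rw [Matrix.trace_eq_sum_roots_charpoly (Q.map (algebraMap ℝ ℂ))] at htr
  have hre : (Q.map (algebraMap ℝ ℂ)).charpoly.roots.sum.re = 0 := by
    rw [← Complex.reCLM_apply, map_multiset_sum]
    refine Multiset.sum_eq_zero fun r hr ↦ ?_
    obtain ⟨z, hz, rfl⟩ := Multiset.mem_map.1 hr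
    have hroot := (Polynomial.mem_roots'.1 hz).2
    rw [← Matrix.charpoly_toLin', ← Module.End.hasEigenvalue_iff_isRoot_charpoly] at hroot
    obtain ⟨w, hw⟩ := hroot.exists_hasEigenvector
    have h1 : (Q.map (algebraMap ℝ ℂ)).mulVec w = z • w := by
      simpa using hw.apply_eq_smul
    have h2 := congrArg (fun P ↦ Matrix.mulVec P w) hC3
    simp only [← Matrix.mulVec_mulVec, Matrix.neg_mulVec, h1, Matrix.mulVec_smul] at h2
    have h3 : (z * z * z + z) • w = 0 := by
      rw [add_smul, mul_smul, mul_smul, h2, neg_add_cancel]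
    have h4 : z * (z * z + 1) = 0 := by
      linear_combination (smul_eq_zero.1 h3).resolve_right hw.2
    rcases mul_eq_zero.1 h4 with h5 | h5
    · simp [h5]
    · have hr := congrArg Complex.re h5
      have hi := congrArg Complex.im h5
      simp at hr hi
      have : z.re * z.im = 0 := by linarith
      rcases mul_eq_zero.1 this with h6 | h6
      · exact h6
      · rw [h6] at hr
        nlinarith [sq_nonneg z.re]
  have := congrArg Complex.re htr
  rw [hre] at this
  simpa using this

section Restriction

variable {E : Type*} [NormedAddCommGroup E] [NormedSpace ℝ E] [FiniteDimensional ℝ E]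
  {H : Type*} [TopologicalSpace H] {I : ModelWithCorners ℝ E H}
  {M : Type*} [TopologicalSpace M] [ChartedSpace H M] [IsManifold I ∞ M]
  {U : TopologicalSpace.Opens M}

theorem fext_two {y : M} (hy : y ∈ U) : fext (2 : SmoothFunction I U) y = 2 := by
  rw [← one_add_one_eq_two, fext_add, Pi.add_apply, fext_one hy, one_add_one_eq_two]

namespace PseudoMetric

variable (g : PseudoMetric I M)

/-- The scalar product of vector fields on an open set. -/
def innerField (s t : SmoothField I U) : SmoothFunction I U :=
  mkFun (fun y ↦ g.inner y (vext s y) (vext t y)) fun _ hy ↦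
    g.contMDiffAt_inner (contMDiffAt_vext s hy) (contMDiffAt_vext t hy)

theorem innerField_apply (s t : SmoothField I U) {y : M} (hy : y ∈ U) :
    fext (g.innerField s t) y = g.inner y (vext s y) (vext t y) :=
  mkFun_apply _ _ hy

variable (U) in
/-- The metric on the vector fields on an open set. -/
def form : SmoothField I U →ₗ[SmoothFunction I U] SmoothField I U →ₗ[SmoothFunction I U]
    SmoothFunction I U :=
  LinearMap.mk₂ _ g.innerField
    (fun s s' t ↦ SmoothFunction.ext fun y hy ↦ by
      simp [fext_add, vext_add, g.innerField_apply _ _ hy])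
    (fun f s t ↦ SmoothFunction.ext fun y hy ↦ by
      simp [fext_mul, vext_smul, g.innerField_apply _ _ hy])
    (fun s t t' ↦ SmoothFunction.ext fun y hy ↦ by
      simp [fext_add, vext_add, g.innerField_apply _ _ hy])
    (fun f s t ↦ SmoothFunction.ext fun y hy ↦ by
      simp [fext_mul, vext_smul, g.innerField_apply _ _ hy])

theorem form_apply (s t : SmoothField I U) {y : M} (hy : y ∈ U) :
    fext (g.form U s t) y = g.inner y (vext s y) (vext t y) :=
  g.innerField_apply s t hy

theorem form_eventuallyEq (s t : SmoothField I U) {y : M} (hy : y ∈ U) :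
    fext (g.form U s t) =ᶠ[𝓝 y] fun z ↦ g.inner z (vext s z) (vext t z) := by
  filter_upwards [U.2.mem_nhds hy] with z hz using g.form_apply s t hz

theorem connection_isMetric : (g.connection U).IsMetric (g.form U) :=
  fun s t u ↦ SmoothFunction.ext fun y hy ↦ by
    rw [fext_act _ _ hy, mvfderiv_congr (g.form_eventuallyEq t u hy), fext_add, Pi.add_apply,
      g.form_apply _ _ hy, g.form_apply _ _ hy, g.nab_apply _ _ hy, g.nab_apply _ _ hy]
    exact g.leviCivita_metric (mdifferentiableAt_vext s hy) (mdifferentiableAt_vext t hy)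
      (mdifferentiableAt_vext u hy)

theorem scalarCurvature_eq_of_ricci_eq {x : M} {ξ : TangentSpace I x}
    {η : TangentSpace I x → ℝ} {c : ℝ} (hη : ∀ a, g.inner x a ξ = η a)
    (hric : ∀ a b, g.ricci x a b = c * (η a * η b)) : g.scalarCurvature x = c * η ξ := by
  have hdet : IsUnit (g.gram x).det := isUnit_iff_ne_zero.2 (g.det_gram_ne_zero (tangentBasis x))
  have h1 : (fun i ↦ η (tangentBasis x i)) = (g.gram x).mulVec ((tangentBasis x).repr ξ) := by
    funext i
    have h := congrArg (g.inner x (tangentBasis x i)) ((tangentBasis x).sum_repr ξ)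
    rw [hη, map_sum] at h
    rw [← h]
    refine Finset.sum_congr rfl fun j _ ↦ ?_
    rw [map_smul, smul_eq_mul, mul_comm]
    rfl
  have h2 : (g.gram x)⁻¹.mulVec (fun i ↦ η (tangentBasis x i)) = (tangentBasis x).repr ξ := by
    rw [h1, Matrix.mulVec_mulVec, Matrix.nonsing_inv_mul _ hdet, Matrix.one_mulVec]
  have h3 : η ξ = ∑ i, (tangentBasis x).repr ξ i * η (tangentBasis x i) := by
    have h := congrArg (g.inner x ξ) ((tangentBasis x).sum_repr ξ)
    rw [hη, map_sum] at h
    rw [← h]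
    refine Finset.sum_congr rfl fun i _ ↦ ?_
    rw [map_smul, smul_eq_mul, g.symm, hη]
  rw [scalarCurvature, h3, Finset.mul_sum]
  refine Finset.sum_congr rfl fun i _ ↦ ?_
  rw [← congrFun h2 i, Matrix.mulVec, dotProduct, Finset.sum_mul, Finset.mul_sum]
  refine Finset.sum_congr rfl fun j _ ↦ ?_
  rw [hric]
  ring

variable {x₀ : M} (hU : ∀ y ∈ U, y ∈ (trivializationAt E (TangentSpace I : M → Type _) x₀).baseSet)
include hU

theorem form_nondegenerate (s : SmoothField I U) (hs : ∀ t, g.form U s t = 0) : s = 0 :=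
  SmoothField.ext fun y hy ↦ by
    rw [vext_zero]
    refine g.nondegenerate y _ fun w ↦ ?_
    have h := congrArg (fun f ↦ fext f y) (hs (constField hU y w))
    simpa only [g.form_apply _ _ hy, constField_apply hU hy, fext_zero] using h

theorem fext_ric (t u : SmoothField I U) {y : M} (hy : y ∈ U) :
    fext ((g.connection U).ric t u) y = g.ricci y (vext t y) (vext u y) := by
  let a : TangentSpace I y →ₗ[ℝ] TangentSpace I y :=
    { toFun := fun w ↦ g.curvature y w (vext t y) (vext u y)
      map_add' := fun w w' ↦ by
        have h := g.vext_curv (constField hU y w + constField hU y w') t u hy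
        rw [vext_add, Pi.add_apply, constField_apply hU hy, constField_apply hU hy] at h
        rw [← h, map_add, LinearMap.add_apply, LinearMap.add_apply, vext_add, Pi.add_apply,
          g.vext_curv _ _ _ hy, g.vext_curv _ _ _ hy, constField_apply hU hy,
          constField_apply hU hy]
      map_smul' := fun r w ↦ by
        have h := g.vext_curv (algebraMap ℝ (SmoothFunction I U) r • constField hU y w) t u hy
        rw [vext_smul, Pi.smul_apply', constField_apply hU hy, fext_algebraMap _ hy] at h
        rw [← h, map_smul, LinearMap.smul_apply, LinearMap.smul_apply, vext_smul, Pi.smul_apply',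
          g.vext_curv _ _ _ hy, constField_apply hU hy, fext_algebraMap _ hy]
        rfl }
  rw [SymmConnection.ric, trace_apply hU _ hy a fun s ↦ g.vext_curv s t u hy,
    LinearMap.trace_eq_matrix_trace ℝ (tangentBasis y)]
  refine Finset.sum_congr rfl fun i _ ↦ ?_
  rw [Matrix.diag_apply, LinearMap.toMatrix_apply]
  rfl

end PseudoMetric

namespace AlmostContactBMetric

variable {n : ℕ} (S : AlmostContactBMetric I M n)

theorem contMDiffAt_phi {X : Π x : M, TangentSpace I x} {x : M} (hX : CMDiffAt ∞ (T% X) x) :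
    CMDiffAt ∞ (T% (fun y ↦ S.phi y (X y))) x :=
  (S.contMDiff_phi x).clm_bundle_apply hX

theorem contMDiffAt_eta {X : Π x : M, TangentSpace I x} {x : M} (hX : CMDiffAt ∞ (T% X) x) :
    CMDiffAt ∞ (fun y ↦ S.eta y (X y)) x := by
  have h : ContMDiffAt I (I.prod 𝓘(ℝ)) ∞ (fun y ↦ TotalSpace.mk' ℝ (E := Bundle.Trivial M ℝ) y
      (S.eta y (X y))) x := (S.contMDiff_eta x).clm_bundle_apply hX
  rw [contMDiffAt_section] at h
  exact h

/-- The structure endomorphism applied to a vector field on an open set. -/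
def phiField (s : SmoothField I U) : SmoothField I U :=
  mkField (fun y ↦ S.phi y (vext s y)) fun _ hy ↦ S.contMDiffAt_phi (contMDiffAt_vext s hy)

theorem phiField_apply (s : SmoothField I U) {y : M} (hy : y ∈ U) :
    vext (S.phiField s) y = S.phi y (vext s y) :=
  mkField_apply _ _ hy

/-- The contact form applied to a vector field on an open set. -/
def etaField (s : SmoothField I U) : SmoothFunction I U :=
  mkFun (fun y ↦ S.eta y (vext s y)) fun _ hy ↦ S.contMDiffAt_eta (contMDiffAt_vext s hy)

theorem etaField_apply (s : SmoothField I U) {y : M} (hy : y ∈ U) :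
    fext (S.etaField s) y = S.eta y (vext s y) :=
  mkFun_apply _ _ hy

variable (U) in
/-- The structure vector field on an open set. -/
def xiField : SmoothField I U := mkField S.xi fun y _ ↦ S.contMDiff_xi y

theorem xiField_apply {y : M} (hy : y ∈ U) : vext (S.xiField U) y = S.xi y :=
  mkField_apply _ _ hy

variable {x₀ : M} (hU : ∀ y ∈ U, y ∈ (trivializationAt E (TangentSpace I : M → Type _) x₀).baseSet)

/-- The structure on the vector fields on an open set. -/
def bMetric : BMetric (SmoothFunction I U) (SmoothField I U) where
  g := S.metric.form U
  φ :=
    { toFun := S.phiField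
      map_add' := fun s t ↦ SmoothField.ext fun y hy ↦ by
        rw [vext_add, Pi.add_apply, S.phiField_apply _ hy, S.phiField_apply _ hy,
          S.phiField_apply _ hy, vext_add, Pi.add_apply, map_add]
      map_smul' := fun f s ↦ SmoothField.ext fun y hy ↦ by
        rw [RingHom.id_apply, vext_smul, Pi.smul_apply', S.phiField_apply _ hy,
          S.phiField_apply _ hy, vext_smul, Pi.smul_apply', map_smul] }
  ξ := S.xiField U
  η :=
    { toFun := S.etaField
      map_add' := fun s t ↦ SmoothFunction.ext fun y hy ↦ by
        rw [fext_add, Pi.add_apply, S.etaField_apply _ hy, S.etaField_apply _ hy,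
          S.etaField_apply _ hy, vext_add, Pi.add_apply, map_add]
      map_smul' := fun f s ↦ SmoothFunction.ext fun y hy ↦ by
        rw [RingHom.id_apply, smul_eq_mul, fext_mul, Pi.mul_apply, S.etaField_apply _ hy,
          S.etaField_apply _ hy, vext_smul, Pi.smul_apply', map_smul, smul_eq_mul] }
  symm s t := SmoothFunction.ext fun y hy ↦ by
    rw [S.metric.form_apply _ _ hy, S.metric.form_apply _ _ hy, S.metric.symm]
  nondeg := S.metric.form_nondegenerate hU
  phi_xi := SmoothField.ext fun y hy ↦ by
    change vext (S.phiField (S.xiField U)) y = _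
    rw [S.phiField_apply _ hy, S.xiField_apply hy, S.phi_xi, vext_zero]
  phi_phi s := SmoothField.ext fun y hy ↦ by
    change vext (S.phiField (S.phiField s)) y = vext (-s + S.etaField s • S.xiField U) y
    rw [S.phiField_apply _ hy, S.phiField_apply _ hy, S.phi_phi, vext_add, Pi.add_apply, vext_neg,
      vext_smul, Pi.smul_apply', S.etaField_apply _ hy, S.xiField_apply hy]
  eta_phi s := SmoothFunction.ext fun y hy ↦ by
    change fext (S.etaField (S.phiField s)) y = _
    rw [S.etaField_apply _ hy, S.phiField_apply _ hy, S.eta_phi, fext_zero]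
  eta_xi := SmoothFunction.ext fun y hy ↦ by
    change fext (S.etaField (S.xiField U)) y = _
    rw [S.etaField_apply _ hy, S.xiField_apply hy, S.eta_xi, fext_one hy]
  phi_g s t := SmoothFunction.ext fun y hy ↦ by
    change fext (S.metric.form U (S.phiField s) (S.phiField t)) y =
      fext (-S.metric.form U s t + S.etaField s * S.etaField t) y
    rw [S.metric.form_apply _ _ hy, S.phiField_apply _ hy, S.phiField_apply _ hy,
      S.metric_phi_phi, fext_add, Pi.add_apply, fext_neg, fext_mul, Pi.mul_apply,
      S.metric.form_apply _ _ hy, S.etaField_apply _ hy, S.etaField_apply _ hy]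

theorem bMetric_phi (s : SmoothField I U) {y : M} (hy : y ∈ U) :
    vext ((S.bMetric hU).φ s) y = S.phi y (vext s y) := S.phiField_apply s hy

theorem bMetric_eta (s : SmoothField I U) {y : M} (hy : y ∈ U) :
    fext ((S.bMetric hU).η s) y = S.eta y (vext s y) := S.etaField_apply s hy

theorem bMetric_xi {y : M} (hy : y ∈ U) : vext (S.bMetric hU).ξ y = S.xi y := S.xiField_apply hy

theorem bMetric_g (s t : SmoothField I U) {y : M} (hy : y ∈ U) :
    fext ((S.bMetric hU).g s t) y = S.metric.inner y (vext s y) (vext t y) :=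
  S.metric.form_apply s t hy

theorem bMetric_associated : (S.bMetric hU).associated.g = S.associatedMetric.form U := by
  ext s t
  refine SmoothFunction.ext fun y hy ↦ ?_
  rw [BMetric.associated_g, fext_add, Pi.add_apply, fext_mul, Pi.mul_apply, S.bMetric_g hU _ _ hy,
    S.bMetric_phi hU _ hy, S.bMetric_eta hU _ hy, S.bMetric_eta hU _ hy,
    S.associatedMetric.form_apply _ _ hy]
  exact (congrArg (· + _) (S.metric_phi y _ _)).symm.trans (S.associatedForm_apply y _ _).symm

theorem IsSasakiLike.bMetric {S : AlmostContactBMetric I M n} (hS : S.IsSasakiLike) :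
    (S.bMetric hU).IsSasakiLike (S.metric.connection U) := fun s t ↦
  SmoothField.ext fun y hy ↦ by
    have h := hS y (vext s y) (vext t) (mdifferentiableAt_vext t hy)
    rw [nablaPhi] at h
    have hφ : vext ((S.bMetric hU).φ t) =ᶠ[𝓝 y] fun z ↦ S.phi z (vext t z) := by
      filter_upwards [U.2.mem_nhds hy] with z hz using S.bMetric_phi hU t hz
    rw [vext_sub, S.metric.nab_apply _ _ hy, S.bMetric_phi hU _ hy, S.metric.nab_apply _ _ hy,
      S.metric.leviCivita_congr (mdifferentiableAt_vext _ hy) hφ, h, vext_add, Pi.add_apply,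
      vext_sub, vext_smul, vext_smul, vext_smul, Pi.smul_apply', Pi.smul_apply', Pi.smul_apply',
      fext_neg, S.bMetric_g hU _ _ hy, S.bMetric_eta hU _ hy, S.bMetric_xi hU hy, fext_mul, fext_mul,
      Pi.mul_apply, Pi.mul_apply, S.bMetric_eta hU _ hy, S.bMetric_eta hU _ hy, fext_two hy]

theorem trace_phi : LinearMap.trace (SmoothFunction I U) (SmoothField I U) (S.bMetric hU).φ = 0 :=
  SmoothFunction.ext fun y hy ↦ by
    have : Module.Finite ℝ (TangentSpace I y) := inferInstanceAs (Module.Finite ℝ E)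
    rw [trace_apply hU _ hy (S.phi y).toLinearMap fun s ↦ S.bMetric_phi hU s hy, fext_zero]
    refine trace_eq_zero_of_cube_eq_neg _ fun a ↦ ?_
    change S.phi y (S.phi y (S.phi y a)) = -S.phi y a
    rw [S.phi_phi, S.eta_phi, zero_smul, add_zero]

end AlmostContactBMetric

end Restriction

namespace AlmostContactBMetric

variable {E : Type*} [NormedAddCommGroup E] [NormedSpace ℝ E] [FiniteDimensional ℝ E]
  {H : Type*} [TopologicalSpace H] {I : ModelWithCorners ℝ E H}
  {M : Type*} [TopologicalSpace M] [ChartedSpace H M] [IsManifold I ∞ M]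
  {U : TopologicalSpace.Opens M} {n : ℕ} (S : AlmostContactBMetric I M n)
  {x₀ : M} (hU : ∀ y ∈ U, y ∈ (trivializationAt E (TangentSpace I : M → Type _) x₀).baseSet)

/-- The torsion free connection preserving `φ`, `ξ` and `η` on a Sasaki-like manifold. -/
def parallelConnection : SymmConnection (fieldAlgebra I U) :=
  (S.metric.connection U).addTensor (S.bMetric hU).shape (S.bMetric hU).shape_symm

variable {S} (hE : Module.finrank ℝ E = 2 * n + 1) (hS : S.IsSasakiLike)

include hS in
theorem isParallel : (S.bMetric hU).IsParallel (S.parallelConnection hU) :=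
  (hS.bMetric hU).isParallel S.metric.connection_isMetric

include hE hU in
theorem trace_id_eq : LinearMap.trace (SmoothFunction I U) (SmoothField I U) LinearMap.id =
    algebraMap ℝ _ (2 * n : ℝ) + 1 := by
  rw [trace_id hU, hE, ← map_one (algebraMap ℝ (SmoothFunction I U)), ← map_add]
  push_cast
  rfl

include hE hS in
theorem connection_ric (s t : SmoothField I U) : (S.metric.connection U).ric s t =
    (S.parallelConnection hU).ric s t
      + algebraMap ℝ _ (2 * n : ℝ) * ((S.bMetric hU).η s * (S.bMetric hU).η t) :=
  have := free_smoothField hU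
  have := finite_smoothField hU
  (isParallel hU hS).ric_leviCivita S.metric.connection_isMetric (S.trace_phi hU)
    (trace_id_eq hU hE) s t

include hE hS in
theorem connection_ric_associated (s t : SmoothField I U) :
    (S.associatedMetric.connection U).ric s t = (S.parallelConnection hU).ric s t
      + algebraMap ℝ _ (2 * n : ℝ) * ((S.bMetric hU).η s * (S.bMetric hU).η t) :=
  have := free_smoothField hU
  have := finite_smoothField hU
  (isParallel hU hS).associated.ric_leviCivita
    (by rw [S.bMetric_associated]; exact S.associatedMetric.connection_isMetric) (S.trace_phi hU)
    (trace_id_eq hU hE) s t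

/-- In dimension one the parallel connection is flat. -/
theorem parallelConnection_ric_of_finrank_eq_one (hE : Module.finrank ℝ E = 1)
    (hS : S.IsSasakiLike) (s t : SmoothField I U) : (S.parallelConnection hU).ric s t = 0 := by
  have ht : t = (S.bMetric hU).η t • (S.bMetric hU).ξ := SmoothField.ext fun y hy ↦ by
    rw [vext_smul, Pi.smul_apply', S.bMetric_eta hU _ hy, S.bMetric_xi hU hy]
    have hxi : S.xi y ≠ 0 := fun h ↦ by
      have := S.eta_xi y
      rw [h, map_zero] at this
      exact zero_ne_one this
    obtain ⟨c, hc⟩ := exists_smul_eq_of_finrank_eq_one (K := ℝ) (V := TangentSpace I y) hE hxi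
      (vext t y)
    rw [← hc, map_smul, S.eta_xi, smul_eq_mul, mul_one]
    rfl
  have h0 : ((S.parallelConnection hU).curv.flip s).flip t = 0 := by
    refine LinearMap.ext fun u ↦ ?_
    rw [LinearMap.flip_apply, LinearMap.flip_apply, ht, map_smul, (isParallel hU hS).curv_xi,
      smul_zero]
    rfl
  rw [SymmConnection.ric, h0, map_zero]

variable {v : Π x : M, TangentSpace I x} (hv : CMDiff ∞ (T% v)) {lam mu nu : ℝ}
  (hsol : S.IsRicciLikeSoliton v lam mu nu)

include hE hS hsol in
theorem isSoliton : (S.bMetric hU).IsSoliton (S.parallelConnection hU)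
    (mkField v fun y _ ↦ hv y) lam mu (2 * n + lam + mu + nu) := fun s t ↦
  SmoothFunction.ext fun y hy ↦ by
    have h := hsol y (vext s) (vext t) (mdifferentiableAt_vext s hy) (mdifferentiableAt_vext t hy)
    have hric := congrArg (fun f ↦ fext f y) (connection_ric hU hE hS s t)
    have hass := S.associatedForm_apply y (vext s y) (vext t y)
    rw [S.metric_phi] at hass
    change S.associatedMetric.inner y (vext s y) (vext t y) = _ at hass
    have hg : fext ((S.bMetric hU).g s t) =ᶠ[𝓝 y] fun z ↦ S.metric.inner z (vext s z) (vext t z) :=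
      S.metric.form_eventuallyEq s t hy
    have hbr : ∀ s : SmoothField I U, vext ((fieldAlgebra I U).br (mkField v fun y _ ↦ hv y) s) y =
        mlieBracket I v (vext s) y := fun s ↦ by
      rw [(vext_br _ s hy).self_of_nhds,
        mlieBracket_congr (vext_mkField v (fun y _ ↦ hv y) hy) (.refl _ (vext s))]
    rw [fext_act _ _ hy, mvfderiv_congr hg, mkField_apply _ _ hy]
    simp only [fext_add, fext_sub, fext_mul, Pi.add_apply, Pi.mul_apply, fext_two hy,
      fext_algebraMap _ hy, S.bMetric_g hU _ _ hy, S.bMetric_phi hU _ hy, S.bMetric_eta hU _ hy,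
      S.metric.fext_ric hU _ _ hy, hbr] at hric ⊢
    rw [hass, hric] at h
    simp only [lieDerivative] at h
    linarith

include hE hS hv hsol in
theorem parallelConnection_ric (s t : SmoothField I U) :
    (S.parallelConnection hU).ric s t = 0 := by
  have := free_smoothField hU
  have := finite_smoothField hU
  rcases Nat.eq_zero_or_pos n with rfl | hn
  · exact parallelConnection_ric_of_finrank_eq_one hU hE hS s t
  · have hk : IsUnit (algebraMap ℝ (SmoothFunction I U) (2 * n : ℝ)) :=
      (isUnit_iff_ne_zero.2 (by positivity)).map _
    exact ((isParallel hU hS).soliton_rigidity (isSoliton hU hE hS hv hsol) (S.trace_phi hU) hk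
      (trace_id_eq hU hE)).1 s t

include hE hS hv hsol in
theorem ricci_eq (x : M) (a b : TangentSpace I x) :
    S.metric.ricci x a b = 2 * n * (S.eta x a * S.eta x b) := by
  let T := trivializationAt E (TangentSpace I : M → Type _) x
  let U : TopologicalSpace.Opens M := ⟨T.baseSet, T.open_baseSet⟩
  have hU : ∀ y ∈ U, y ∈ T.baseSet := fun _ hy ↦ hy
  have hx : x ∈ U := mem_baseSet_trivializationAt E _ x
  have h := S.metric.fext_ric hU (constField hU x a) (constField hU x b) hx
  rw [connection_ric hU hE hS, parallelConnection_ric hU hE hS hv hsol, zero_add] at h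
  simp only [fext_mul, Pi.mul_apply, fext_algebraMap _ hx, S.bMetric_eta hU _ hx,
    constField_apply hU hx] at h
  exact h.symm

include hE hS hv hsol in
theorem ricci_associated_eq (x : M) (a b : TangentSpace I x) :
    S.associatedMetric.ricci x a b = 2 * n * (S.eta x a * S.eta x b) := by
  let T := trivializationAt E (TangentSpace I : M → Type _) x
  let U : TopologicalSpace.Opens M := ⟨T.baseSet, T.open_baseSet⟩
  have hU : ∀ y ∈ U, y ∈ T.baseSet := fun _ hy ↦ hy
  have hx : x ∈ U := mem_baseSet_trivializationAt E _ x
  have h := S.associatedMetric.fext_ric hU (constField hU x a) (constField hU x b) hx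
  rw [connection_ric_associated hU hE hS, parallelConnection_ric hU hE hS hv hsol, zero_add] at h
  simp only [fext_mul, Pi.mul_apply, fext_algebraMap _ hx, S.bMetric_eta hU _ hx,
    constField_apply hU hx] at h
  exact h.symm

include hE hS hv hsol in
theorem scalarCurvature_eq (x : M) : S.metric.scalarCurvature x = 2 * n := by
  rw [S.metric.scalarCurvature_eq_of_ricci_eq (S.metric_xi x) (ricci_eq hE hS hv hsol x),
    S.eta_xi, mul_one]

include hE hS hv hsol in
theorem scalarCurvature_associated_eq (x : M) : S.associatedMetric.scalarCurvature x = 2 * n := by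
  have h : ∀ a, S.associatedMetric.inner x a (S.xi x) = S.eta x a := fun a ↦ by
    refine (S.associatedForm_apply x a (S.xi x)).trans ?_
    rw [S.phi_xi, map_zero, S.eta_xi, mul_one, zero_add]
  rw [S.associatedMetric.scalarCurvature_eq_of_ricci_eq h (ricci_associated_eq hE hS hv hsol x),
    S.eta_xi, mul_one]

include hE hS hv hsol in
/-- The potential preserves the contact form and its bracket with `ξ` is horizontal. -/
theorem lie_eta_eq_zero (hn : 0 < n) {x : M} {X : Π x : M, TangentSpace I x}
    (hX : MDiffAt (T% X) x) :
    d% (fun y ↦ S.eta y (X y)) x (v x) = S.eta x (mlieBracket I v X x) ∧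
      S.eta x (mlieBracket I v S.xi x) = 0 := by
  let T := trivializationAt E (TangentSpace I : M → Type _) x
  let U : TopologicalSpace.Opens M := ⟨T.baseSet, T.open_baseSet⟩
  have hU : ∀ y ∈ U, y ∈ T.baseSet := fun _ hy ↦ hy
  have hx : x ∈ U := mem_baseSet_trivializationAt E _ x
  have := free_smoothField hU
  have := finite_smoothField hU
  have hk : IsUnit (algebraMap ℝ (SmoothFunction I U) (2 * n : ℝ)) :=
    (isUnit_iff_ne_zero.2 (by positivity)).map _
  obtain ⟨-, h2, h3⟩ := (isParallel hU hS).soliton_rigidity (isSoliton hU hE hS hv hsol)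
    (S.trace_phi hU) hk (trace_id_eq hU hE)
  have hbr : ∀ s : SmoothField I U, vext ((fieldAlgebra I U).br (mkField v fun y _ ↦ hv y) s) x =
      mlieBracket I v (vext s) x := fun s ↦ by
    rw [(vext_br _ s hx).self_of_nhds,
      mlieBracket_congr (vext_mkField v (fun y _ ↦ hv y) hx) (.refl _ (vext s))]
  refine ⟨?_, ?_⟩
  · let s := constField hU x (X x)
    have hs : vext s x = X x := constField_apply hU hx _
    have h4 := congrArg (fun f ↦ fext f x)
      ((isParallel hU hS).lie_eta (mkField v fun y _ ↦ hv y) s)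
    have hη : fext ((S.bMetric hU).η s) =ᶠ[𝓝 x] fun y ↦ S.eta y (vext s y) := by
      filter_upwards [U.2.mem_nhds hx] with z hz using S.bMetric_eta hU s hz
    simp only [h2, add_zero, fext_act _ _ hx, S.bMetric_eta hU _ hx, hbr, mvfderiv_congr hη,
      mkField_apply _ _ hx] at h4
    have hξ : MDiffAt (T% S.xi) x := (S.contMDiff_xi x).mdifferentiableAt (by simp)
    have h5 := hsol x X S.xi hX hξ
    have h6 := hsol x (vext s) S.xi (mdifferentiableAt_vext s hx) hξ
    simp only [lieDerivative, S.metric_xi] at h5 h6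
    rw [hs] at h6
    linarith
  · have h7 := congrArg (fun f ↦ fext f x) h3
    simp only [S.bMetric_eta hU _ hx, hbr, fext_zero] at h7
    have hξ : vext (S.bMetric hU).ξ =ᶠ[𝓝 x] S.xi := by
      filter_upwards [U.2.mem_nhds hx] with z hz using S.bMetric_xi hU hz
    rwa [mlieBracket_congr (.refl _ v) hξ] at h7

include hE hS hv hsol in
theorem lieDerivative_ricci_xi {x : M} {X : Π x : M, TangentSpace I x}
    (hX : MDiffAt (T% X) x) : lieDerivative v S.metric.ricci X S.xi x = 0 := by
  have hη : MDiffAt (fun y ↦ S.eta y (X y)) x := by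
    have h := S.metric.mdifferentiableAt_inner hX
      ((S.contMDiff_xi x).mdifferentiableAt (by simp))
    simpa only [S.metric_xi] using h
  have hd : d% (fun y ↦ 2 * n * S.eta y (X y)) x (v x) =
      2 * n * d% (fun y ↦ S.eta y (X y)) x (v x) := by
    have h := mvfderiv_mul (f := fun _ : M ↦ (2 * n : ℝ)) mdifferentiableAt_const hη
    rw [mvfderiv_const, smul_zero, add_zero] at h
    exact congrArg (· (v x)) h
  simp only [lieDerivative, ricci_eq hE hS hv hsol, S.eta_xi, mul_one]
  rw [hd]
  rcases Nat.eq_zero_or_pos n with rfl | hn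
  · simp
  · obtain ⟨h1, h2⟩ := lie_eta_eq_zero hE hS hv hsol hn hX
    rw [h1, h2]
    ring

end AlmostContactBMetric

end ContactB
end
theorem proposition3p2 (n : ℕ) {M : Type*} [TopologicalSpace M] [T2Space M]
    [SecondCountableTopology M] [ChartedSpace (EuclideanSpace ℝ (Fin (2 * n + 1))) M]
    [IsManifold (𝓡 (2 * n + 1)) ∞ M]
    (S : ContactB.AlmostContactBMetric (𝓡 (2 * n + 1)) M n) (hS : S.IsSasakiLike)
    (v : Π x : M, TangentSpace (𝓡 (2 * n + 1)) x)
    (hv : ContMDiff (𝓡 (2 * n + 1)) (𝓡 (2 * n + 1)).tangent ∞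
      (fun x ↦ (⟨x, v x⟩ : TangentBundle (𝓡 (2 * n + 1)) M)))
    (lam mu nu : ℝ) (hsol : S.IsRicciLikeSoliton v lam mu nu) :
    (∀ (x : M) (X : Π x : M, TangentSpace (𝓡 (2 * n + 1)) x),
      MDifferentiableAt (𝓡 (2 * n + 1)) (𝓡 (2 * n + 1)).tangent
        (fun y ↦ (⟨y, X y⟩ : TangentBundle (𝓡 (2 * n + 1)) M)) x →
      ContactB.lieDerivative v S.metric.ricci X S.xi x = 0) ∧
    (∀ x : M, S.metric.scalarCurvature x = 2 * n) ∧
    (∃ c : ℝ, ∀ x : M, S.associatedMetric.scalarCurvature x = c) := by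
  have hE : Module.finrank ℝ (EuclideanSpace ℝ (Fin (2 * n + 1))) = 2 * n + 1 :=
    finrank_euclideanSpace_fin
  exact ⟨fun _ _ hX ↦ ContactB.AlmostContactBMetric.lieDerivative_ricci_xi hE hS hv hsol hX,
    ContactB.AlmostContactBMetric.scalarCurvature_eq hE hS hv hsol,
    2 * n, ContactB.AlmostContactBMetric.scalarCurvature_associated_eq hE hS hv hsol⟩
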